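/- Let $\mathbb{D}$ be the open unit disc, $p\in(1,\infty)$, $\alpha>-1$. Let $X$ be either the Hardy space $H^p$ of holomorphic $f$ on $\mathbb D$ with $\|f\|_{H^p}=\sup_{0\le r<1}\big(\frac1{2\pi}\int_0^{2\pi}|f(re^{iu})|^p\,du\big)^{1/p}=\lim_{r\to1^-}\big(\frac1{2\pi}\int_0^{2\pi}|f(re^{iu})|^p\,du\big)^{1/p}<\infty$, or the weighted Bergman space $A^p_\alpha$ of holomorphic $f$ on $\mathbb D$ with $\|f\|_{A^p_\alpha}=\big(\frac{\alpha+1}{\pi}\int_{\mathbb D}|f(z)|^p(1-|z|^2)^\alpha\,d\mathrm{Leb}(z)\big)^{1/p}<\infty$. For a bounded linear operator $S$ on $X$ put $$\mathcal{EN}(S)=\sup_{(f_n)}\limsup_{n\to\infty}\|Sf_n\|_X,$$ where the supremum is over all sequences $(f_n)$ of unit vectors in $X$ that converge weakly to $0$. For each $t\in(0,1)$ let $g_t$ belong to the disc algebra, that is, $g_t$ is continuous on $\overline{\mathbb D}$ and holomorphic on $\mathbb D$, and let $M_{g_t}f=g_tf$ be the corresponding multiplication operator on $X$; write $\|g\|_\infty=\sup_{z\in\mathbb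 D}|g(z)|$. Suppose that the family $(M_{g_t})_{t\in(0,1)}$ satisfies $W(X)$: for every $f\in X$, the map $t\mapsto M_{g_t}f$ from $(0,1)$ to $X$ is continuous and $\int_0^1\|M_{g_t}f\|_X\,dt<\infty$. Then $f\mapsto\int_0^1M_{g_t}f\,dt$ (Bochner integral) is a bounded linear operator on $X$, denoted $\int_0^1M_{g_t}\,dt$, and $$\mathcal{EN}\Big(\int_0^1M_{g_t}\,dt\Big)\le\int_0^1\mathcal{EN}(M_{g_t})\,dt,$$ where the right-hand side is an element of $[0,\infty]$. Equality holds if and only if there exist $\xi,\theta\in\mathbb C$ with $|\xi|=|\theta|=1$ such that $\theta g_t(\xi)=\|g_t\|_\infty$ for almost every $t\in(0,1)$. -/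

import Mathlib

open Set Filter Topology MeasureTheory
open scoped ENNReal

noncomputable section

namespace DiscSpaces

/-- The open unit disc. -/
abbrev disc : Set ℂ := Metric.ball (0 : ℂ) 1

/-- Normalised arc-length measure on the circle of radius `r` about `0`:
`∫ F d(circleMeasure r) = (2π)⁻¹ ∫_0^{2π} F (r e^{iu}) du`. -/
def circleMeasure (r : ℝ) : Measure ℂ :=
  Measure.map (circleMap 0 r)
    ((ENNReal.ofReal (2 * Real.pi))⁻¹ • volume.restrict (Ioc 0 (2 * Real.pi)))

/-- The family of circle measures, `0 ≤ r < 1`; it defines the Hardy spaces. -/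
def hardyMeasures (r : Ico (0 : ℝ) 1) : Measure ℂ := circleMeasure r

/-- The weighted area measure `(α + 1) (1 - |z|²)^α dA(z)` on the unit disc, where `dA` is
Lebesgue measure divided by `π`. -/
def bergmanMeasure (α : ℝ) : Measure ℂ :=
  (volume.restrict disc).withDensity
    fun z => ENNReal.ofReal ((α + 1) / Real.pi * (1 - ‖z‖ ^ 2) ^ α)

/-- The one-element family that defines the weighted Bergman spaces. -/
def bergmanMeasures (α : ℝ) (_ : Unit) : Measure ℂ := bergmanMeasure α

/-- The extended norm `sup_i (∫ |f|^p dμ_i)^{1/p}`. -/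
def extNorm {ι : Type} (p : ℝ≥0∞) (μ : ι → Measure ℂ) (f : ℂ → ℂ) : ℝ≥0∞ :=
  ⨆ i, eLpNorm f p (μ i)

lemma measurable_of_holo {f : ℂ → ℂ} (hf : DifferentiableOn ℂ f disc)
    (h0 : ∀ z ∉ disc, f z = 0) : Measurable f := by
  classical
  have h : f = disc.piecewise f 0 := by
    ext z
    by_cases hz : z ∈ disc
    · rw [Set.piecewise_eq_of_mem _ _ _ hz]
    · rw [Set.piecewise_eq_of_notMem _ _ _ hz, h0 z hz]; rfl
  rw [h]
  exact hf.continuousOn.measurable_piecewise continuousOn_const measurableSet_ball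

lemma extNorm_add_le {ι : Type} {p : ℝ≥0∞} (hp : 1 ≤ p) (μ : ι → Measure ℂ) {f g : ℂ → ℂ}
    (hf : Measurable f) (hg : Measurable g) :
    extNorm p μ (f + g) ≤ extNorm p μ f + extNorm p μ g := by
  refine iSup_le fun i => ?_
  refine (eLpNorm_add_le hf.aestronglyMeasurable hg.aestronglyMeasurable hp).trans ?_
  exact add_le_add (le_iSup (fun i => eLpNorm f p (μ i)) i)
    (le_iSup (fun i => eLpNorm g p (μ i)) i)

lemma extNorm_smul {ι : Type} (p : ℝ≥0∞) (μ : ι → Measure ℂ) (c : ℂ) (f : ℂ → ℂ) :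
    extNorm p μ (c • f) = ‖c‖ₑ * extNorm p μ f := by
  simp only [extNorm, eLpNorm_const_smul, ENNReal.mul_iSup]

lemma extNorm_mul_le {ι : Type} (p : ℝ≥0∞) (μ : ι → Measure ℂ) {g f : ℂ → ℂ} {C : ℝ}
    (hg : ∀ z ∈ disc, ‖g z‖ ≤ C) (hf : ∀ z ∉ disc, f z = 0) :
    extNorm p μ (fun z => g z * f z) ≤ ENNReal.ofReal C * extNorm p μ f := by
  refine iSup_le fun i => ?_
  refine (eLpNorm_le_mul_eLpNorm_of_ae_le_mul (c := C) (g := f)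
    (Eventually.of_forall fun z => ?_) p).trans ?_
  · by_cases hz : z ∈ disc
    · rw [norm_mul]
      exact mul_le_mul_of_nonneg_right (hg z hz) (norm_nonneg _)
    · simp [hf z hz]
  · exact mul_le_mul_right (le_iSup (fun i => eLpNorm f p (μ i)) i) _

/-- The holomorphic functions on the unit disc with finite `extNorm`. A function on the disc is
encoded by its extension by `0` to `ℂ`, so that equality is equality on the disc. -/
def holoSubmodule {ι : Type} (p : ℝ≥0∞) [Fact (1 ≤ p)] (μ : ι → Measure ℂ) :
    Submodule ℂ (ℂ → ℂ) where
  carrier := {f | DifferentiableOn ℂ f disc ∧ (∀ z ∉ disc, f z = 0) ∧ extNorm p μ f < ∞}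
  zero_mem' := ⟨differentiableOn_const 0, fun _ _ => rfl, by simp [extNorm]⟩
  add_mem' := by
    rintro f g ⟨hf, hf0, hfn⟩ ⟨hg, hg0, hgn⟩
    refine ⟨hf.add hg, fun z hz => by simp [hf0 z hz, hg0 z hz], ?_⟩
    exact (extNorm_add_le Fact.out μ (measurable_of_holo hf hf0)
      (measurable_of_holo hg hg0)).trans_lt (ENNReal.add_lt_top.2 ⟨hfn, hgn⟩)
  smul_mem' := by
    rintro c f ⟨hf, hf0, hfn⟩
    refine ⟨hf.const_smul c, fun z hz => by simp [hf0 z hz], ?_⟩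
    rw [extNorm_smul]
    exact ENNReal.mul_lt_top enorm_lt_top hfn

/-- The space of holomorphic functions on the disc with finite norm
`‖f‖ = sup_i (∫ |f|^p dμ_i)^{1/p}`. -/
def HoloSpace {ι : Type} (p : ℝ≥0∞) [Fact (1 ≤ p)] (μ : ι → Measure ℂ) : Type :=
  ↥(holoSubmodule p μ)

/-- A family of measures that does not annihilate any nonzero holomorphic function. -/
class Separating {ι : Type} (μ : ι → Measure ℂ) : Prop where
  eq_zero : ∀ f : ℂ → ℂ, DifferentiableOn ℂ f disc → (∀ i, f =ᵐ[μ i] 0) → ∀ z ∈ disc, f z = 0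

instance : Separating hardyMeasures where
  eq_zero := by
    intro f hf h z hz
    have hz1 : ‖z‖ < 1 := by simpa using hz
    have h1 := h ⟨‖z‖, norm_nonneg z, hz1⟩
    have hm : AEMeasurable (circleMap 0 ‖z‖)
        ((ENNReal.ofReal (2 * Real.pi))⁻¹ • volume.restrict (Ioc 0 (2 * Real.pi))) :=
      (continuous_circleMap 0 ‖z‖).measurable.aemeasurable
    have h2 := ae_of_ae_map hm h1
    rw [Measure.ae_ennreal_smul_measure_iff (ENNReal.inv_ne_zero.2 ENNReal.ofReal_ne_top)] at h2
    have hc : Continuous fun u : ℝ => f (circleMap 0 ‖z‖ u) := by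
      refine hf.continuousOn.comp_continuous (continuous_circleMap 0 ‖z‖) fun u => ?_
      simpa using hz1
    have h3 : EqOn (fun u : ℝ => f (circleMap 0 ‖z‖ u)) (fun _ => 0) (Ioc 0 (2 * Real.pi)) :=
      Measure.eqOn_Ioc_of_ae_eq volume h2 hc.continuousOn continuousOn_const
    have h5 : z ∈ circleMap 0 ‖z‖ '' Ioc 0 (2 * Real.pi) := by
      rw [image_circleMap_Ioc]
      simp
    obtain ⟨u, hu, hzu⟩ := h5
    rw [← hzu]
    exact h3 hu

instance (α : ℝ) [hα : Fact (-1 < α)] : Separating (bergmanMeasures α) where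
  eq_zero := by
    intro f hf h z hz
    have h1 : f =ᵐ[(volume.restrict disc).withDensity
      fun z => ENNReal.ofReal ((α + 1) / Real.pi * (1 - ‖z‖ ^ 2) ^ α)] 0 := h ()
    have hα' : 0 < α + 1 := by linarith [hα.out]
    rw [EventuallyEq, ae_withDensity_iff (by fun_prop), ae_restrict_iff' measurableSet_ball] at h1
    have h2 : f =ᵐ[volume.restrict disc] 0 := by
      rw [EventuallyEq, ae_restrict_iff' measurableSet_ball]
      filter_upwards [h1] with w hw hwd
      refine hw hwd ?_
      have hw1 : ‖w‖ < 1 := by simpa using hwd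
      have : 0 < 1 - ‖w‖ ^ 2 := by nlinarith [norm_nonneg w]
      have := Real.rpow_pos_of_pos this α
      have h3 : 0 < (α + 1) / Real.pi * (1 - ‖w‖ ^ 2) ^ α := by positivity
      simpa using h3
    exact Measure.eqOn_open_of_ae_eq h2 Metric.isOpen_ball hf.continuousOn continuousOn_const hz

namespace HoloSpace

variable {ι : Type} {p : ℝ≥0∞} [Fact (1 ≤ p)] {μ : ι → Measure ℂ}

instance : AddCommGroup (HoloSpace p μ) := inferInstanceAs (AddCommGroup ↥(holoSubmodule p μ))

instance : Module ℂ (HoloSpace p μ) := inferInstanceAs (Module ℂ ↥(holoSubmodule p μ))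

instance : CoeFun (HoloSpace p μ) fun _ => ℂ → ℂ := ⟨Subtype.val⟩

instance : Norm (HoloSpace p μ) := ⟨fun f => (extNorm p μ f).toReal⟩

lemma norm_core [Separating μ] : NormedSpace.Core ℂ (HoloSpace p μ) where
  norm_nonneg f := ENNReal.toReal_nonneg
  norm_smul c f := by
    change (extNorm p μ (c • f.1)).toReal = _
    rw [extNorm_smul, ENNReal.toReal_mul, toReal_enorm]
    rfl
  norm_triangle f g := by
    change (extNorm p μ (f.1 + g.1)).toReal ≤ (extNorm p μ f).toReal + (extNorm p μ g).toReal
    rw [← ENNReal.toReal_add f.2.2.2.ne g.2.2.2.ne]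
    exact ENNReal.toReal_mono (ENNReal.add_ne_top.2 ⟨f.2.2.2.ne, g.2.2.2.ne⟩)
      (extNorm_add_le Fact.out μ (measurable_of_holo f.2.1 f.2.2.1)
        (measurable_of_holo g.2.1 g.2.2.1))
  norm_eq_zero_iff f := by
    constructor
    · intro h
      have h1 : extNorm p μ f = 0 :=
        ((ENNReal.toReal_eq_zero_iff _).1 h).resolve_right f.2.2.2.ne
      have hp : p ≠ 0 := (zero_lt_one.trans_le (Fact.out : 1 ≤ p)).ne'
      have h2 := Separating.eq_zero (μ := μ) f f.2.1 fun i =>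
        (eLpNorm_eq_zero_iff (measurable_of_holo f.2.1 f.2.2.1).aestronglyMeasurable hp).1
          (ENNReal.iSup_eq_zero.1 h1 i)
      refine Subtype.ext (funext fun z => ?_)
      by_cases hz : z ∈ disc
      · exact h2 z hz
      · exact f.2.2.1 z hz
    · rintro rfl
      change (extNorm p μ 0).toReal = 0
      simp [extNorm]

instance [Separating μ] : NormedAddCommGroup (HoloSpace p μ) :=
  NormedAddCommGroup.ofCore norm_core

instance [Separating μ] : NormedSpace ℂ (HoloSpace p μ) := NormedSpace.ofCore norm_core

end HoloSpace

/-- The Hardy space `H^p`, with norm `sup_{0 ≤ r < 1} ((2π)⁻¹ ∫_0^{2π} |f(r e^{iu})|^p du)^{1/p}`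
(the integral means increase with `r`, so this is the limit for `r → 1`). -/
abbrev Hardy (p : ℝ≥0∞) [Fact (1 ≤ p)] : Type := HoloSpace p hardyMeasures

/-- The weighted Bergman space `A^p_α`, with norm
`(∫_𝔻 |f(z)|^p (α + 1) (1 - |z|²)^α dA(z))^{1/p}`. -/
abbrev Bergman (p : ℝ≥0∞) [Fact (1 ≤ p)] (α : ℝ) : Type := HoloSpace p (bergmanMeasures α)

/-- Bounded holomorphic functions on the disc. Values outside the disc are free; for a function
that extends continuously to the closed disc they may be the values of the extension. -/
structure HInfty where
  toFun : ℂ → ℂ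
  holo : DifferentiableOn ℂ toFun disc
  bdd : ∃ C : ℝ, ∀ z ∈ disc, ‖toFun z‖ ≤ C

instance : CoeFun HInfty fun _ => ℂ → ℂ := ⟨HInfty.toFun⟩

/-- `‖g‖_∞ = sup_{|z| < 1} |g z|`. -/
def HInfty.supNorm (g : HInfty) : ℝ := ⨆ z : disc, ‖g z‖

/-- `g` belongs to the disc algebra: it is continuous on the closed disc. -/
def HInfty.IsDiscAlgebra (g : HInfty) : Prop := ContinuousOn g (Metric.closedBall (0 : ℂ) 1)

/-- The multiplication operator `M_g f = g f`. -/
def mulOp {ι : Type} {p : ℝ≥0∞} [Fact (1 ≤ p)] {μ : ι → Measure ℂ} [Separating μ] (g : HInfty) :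
    HoloSpace p μ →L[ℂ] HoloSpace p μ :=
  LinearMap.mkContinuousOfExistsBound
    { toFun := fun f => ⟨fun z => g z * f z, g.holo.mul f.2.1,
        fun z hz => by simp [f.2.2.1 z hz],
        (extNorm_mul_le p μ g.bdd.choose_spec f.2.2.1).trans_lt
          (ENNReal.mul_lt_top ENNReal.ofReal_lt_top f.2.2.2)⟩
      map_add' := fun f h => Subtype.ext (funext fun z => mul_add (g z) (f z) (h z))
      map_smul' := fun c f => Subtype.ext (funext fun z => mul_left_comm (g z) c (f z)) }
    (by
      refine ⟨max g.bdd.choose 0, fun f => ?_⟩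
      have h := extNorm_mul_le p μ g.bdd.choose_spec f.2.2.1
      refine (ENNReal.toReal_mono
        (ENNReal.mul_lt_top ENNReal.ofReal_lt_top f.2.2.2).ne h).trans_eq ?_
      rw [ENNReal.toReal_mul, ENNReal.toReal_ofReal']
      rfl)

lemma mulOp_apply {ι : Type} {p : ℝ≥0∞} [Fact (1 ≤ p)] {μ : ι → Measure ℂ} [Separating μ]
    (g : HInfty) (f : HoloSpace p μ) (z : ℂ) : mulOp g f z = g z * f z := rfl

end DiscSpaces

section Operators

variable {X : Type*} [NormedAddCommGroup X] [NormedSpace ℂ X]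

/-- Weak convergence to `0` of a sequence. -/
def WeaklyNull (f : ℕ → X) : Prop :=
  ∀ φ : X →L[ℂ] ℂ, Tendsto (fun n => φ (f n)) atTop (𝓝 0)

/-- `EN(S) = sup limsup_n ‖S f_n‖`, the supremum over all weakly null sequences `(f_n)` of unit
vectors. -/
def EN (S : X →L[ℂ] X) : ℝ≥0∞ :=
  ⨆ (f : ℕ → X) (_ : ∀ n, ‖f n‖ = 1) (_ : WeaklyNull f), limsup (fun n => ‖S (f n)‖ₑ) atTop

/-- The condition `W(X)` for the family `S_t`, `0 < t < 1`: for every `f ∈ X` the map `t ↦ S_t f`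
is continuous and `∫_0^1 ‖S_t f‖ dt < ∞`. -/
structure ConditionW (S : ℝ → X →L[ℂ] X) : Prop where
  continuousOn : ∀ f, ContinuousOn (fun t => S t f) (Ioo 0 1)
  lintegral_lt_top : ∀ f, ∫⁻ t in Ioo (0 : ℝ) 1, ‖S t f‖ₑ < ∞

/-- `T` is the operator `∫_0^1 S_t dt`, that is, `T f = ∫_0^1 S_t f dt` for every `f`, where the
integral is the Bochner integral of an integrable `X`-valued function. -/
def IsOperatorIntegral (S : ℝ → X →L[ℂ] X) (T : X →L[ℂ] X) : Prop :=
  ∀ f, IntegrableOn (fun t => S t f) (Ioo 0 1) ∧ T f = ∫ t in Ioo (0 : ℝ) 1, S t f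

end Operators

end

/-! Hardy and Bergman spaces are treated at once: both carry a norm that is a supremum of `L^p`
norms, and only the properties collected in `Admissible` are used.

The main tool is a sequence of bounded unit vectors concentrating at a boundary point ξ, the
normalised powers of (1 + ξ̄z)/2 (`exists_concentratesAt`). On it, multiplication by a disc algebra
function g acts asymptotically as the scalar g(ξ) (`tendsto_mulOp_sub`). It is weakly null when p >
1 (`weaklyNull`): N sparsely chosen members are almost disjointly supported, so suitable unimodular
combinations of them have norm of order N^{1/p}, whereas a functional that does not tend to 0 along
the sequence would take values of order N. Taking ξ to be a maximum point of |g| gives EN(M_g) =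
‖g‖_∞ (`EN_mulOp`).

The operator integral is multiplication by G(z) = ∫ g_t(z) dt (`operatorIntegral_apply`), and the
inequality is the triangle inequality for integrals. If θ g_t(ξ) = ‖g_t‖_∞ for almost every t,
testing on the sequence at ξ gives EN(T) ≥ |G(ξ)| = ∫ ‖g_t‖_∞ dt. Conversely, equality makes ∫
‖g_t‖_∞ dt finite, so G is continuous on the closed disc and |G| has a maximum point ξ on the
circle. Then ∫ ‖g_t‖_∞ ≤ EN(T) ≤ ‖T‖ ≤ |G(ξ)| ≤ ∫ |g_t(ξ)| ≤ ∫ ‖g_t‖_∞, and equality throughout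
forces the values g_t(ξ) to have maximal modulus and a common phase. -/

section Operators

variable {X : Type*} [NormedAddCommGroup X] [NormedSpace ℂ X]

/-! ### Bounds for `EN` and existence of the operator integral -/

lemma EN_le_enorm (S : X →L[ℂ] X) : EN S ≤ ‖S‖ₑ := by
  refine iSup_le fun f => iSup_le fun hf => iSup_le fun _ => ?_
  refine limsup_le_of_le (h := Eventually.of_forall fun n => ?_)
  refine (S.le_opENorm (f n)).trans ?_
  rw [← ofReal_norm (f n), hf n]
  simp

lemma le_EN {S : X →L[ℂ] X} {f : ℕ → X} (hf : ∀ n, ‖f n‖ = 1) (hw : WeaklyNull f) {a : ℝ≥0∞}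
    (h : Tendsto (fun n => ‖S (f n)‖ₑ) atTop (𝓝 a)) : a ≤ EN S := by
  rw [← h.limsup_eq]
  exact le_iSup_of_le f (le_iSup_of_le hf (le_iSup_of_le hw le_rfl))

namespace ConditionW

variable {S : ℝ → X →L[ℂ] X}

lemma aestronglyMeasurable (h : ConditionW S) (f : X) :
    AEStronglyMeasurable (fun t => S t f) (volume.restrict (Ioo (0 : ℝ) 1)) :=
  (h.continuousOn f).aestronglyMeasurable measurableSet_Ioo

lemma integrableOn (h : ConditionW S) (f : X) : IntegrableOn (fun t => S t f) (Ioo (0 : ℝ) 1) :=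
  ⟨h.aestronglyMeasurable f, h.lintegral_lt_top f⟩

/-- The `L¹` norm of `t ↦ S_t f` as a seminorm in `f`. -/
noncomputable def seminorm (h : ConditionW S) : Seminorm ℂ X :=
  Seminorm.of (fun f => (∫⁻ t in Ioo (0 : ℝ) 1, ‖S t f‖ₑ).toReal)
    (fun f g => by
      rw [← ENNReal.toReal_add (h.lintegral_lt_top f).ne (h.lintegral_lt_top g).ne,
        ← lintegral_add_left' (h.aestronglyMeasurable f).enorm]
      refine ENNReal.toReal_mono ?_ (lintegral_mono fun t => ?_)
      · rw [lintegral_add_left' (h.aestronglyMeasurable f).enorm]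
        exact ENNReal.add_ne_top.2 ⟨(h.lintegral_lt_top f).ne, (h.lintegral_lt_top g).ne⟩
      · simp only [map_add]
        exact enorm_add_le _ _)
    (fun c f => by
      simp only [map_smul, enorm_smul]
      rw [lintegral_const_mul' _ _ enorm_ne_top, ENNReal.toReal_mul, toReal_enorm])

/-- Fatou's lemma, since each `S t` is continuous. -/
lemma lowerSemicontinuous_seminorm (h : ConditionW S) : LowerSemicontinuous h.seminorm := by
  refine lowerSemicontinuous_iff_isClosed_preimage.2 fun y => IsSeqClosed.isClosed ?_
  intro f f₀ hf hlim
  have hy : 0 ≤ y := (apply_nonneg h.seminorm (f 0)).trans (hf 0)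
  have hf' : ∀ n, ∫⁻ t in Ioo (0 : ℝ) 1, ‖S t (f n)‖ₑ ≤ ENNReal.ofReal y := fun n =>
    (ENNReal.le_ofReal_iff_toReal_le (h.lintegral_lt_top _).ne hy).2 (hf n)
  have key : ∫⁻ t in Ioo (0 : ℝ) 1, ‖S t f₀‖ₑ ≤ ENNReal.ofReal y := by
    calc ∫⁻ t in Ioo (0 : ℝ) 1, ‖S t f₀‖ₑ
        = ∫⁻ t in Ioo (0 : ℝ) 1, liminf (fun n => ‖S t (f n)‖ₑ) atTop := by
          refine lintegral_congr fun t => ?_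
          exact ((((S t).continuous.tendsto f₀).comp hlim).enorm.liminf_eq).symm
      _ ≤ liminf (fun n => ∫⁻ t in Ioo (0 : ℝ) 1, ‖S t (f n)‖ₑ) atTop :=
          lintegral_liminf_le' fun n => (h.aestronglyMeasurable _).enorm
      _ ≤ ENNReal.ofReal y :=
          liminf_le_of_le (h := fun b hb => by
            obtain ⟨n, hn⟩ := hb.exists
            exact hn.trans (hf' n))
  exact (ENNReal.le_ofReal_iff_toReal_le (h.lintegral_lt_top _).ne hy).1 key

/-- A Banach space is barrelled, so a lower semicontinuous seminorm on it is continuous. This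
uniform bound makes the integral a bounded operator. -/
lemma exists_lintegral_le [CompleteSpace X] (h : ConditionW S) :
    ∃ C : ℝ, 0 < C ∧ ∀ f, ∫⁻ t in Ioo (0 : ℝ) 1, ‖S t f‖ₑ ≤ ENNReal.ofReal (C * ‖f‖) := by
  have hc := Seminorm.continuous_of_lowerSemicontinuous h.seminorm h.lowerSemicontinuous_seminorm
  obtain ⟨C, hC, hb⟩ := Seminorm.bound_of_continuous_normedSpace h.seminorm hc
  refine ⟨C, hC, fun f => ?_⟩
  exact (ENNReal.le_ofReal_iff_toReal_le (h.lintegral_lt_top _).ne (by positivity)).2 (hb f)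

lemma exists_isOperatorIntegral [CompleteSpace X] (h : ConditionW S) :
    ∃ T : X →L[ℂ] X, IsOperatorIntegral S T := by
  obtain ⟨C, hC, hb⟩ := h.exists_lintegral_le
  refine ⟨LinearMap.mkContinuous
    { toFun := fun f => ∫ t in Ioo (0 : ℝ) 1, S t f
      map_add' := fun f g => by
        simp only [map_add]
        exact integral_add (h.integrableOn f) (h.integrableOn g)
      map_smul' := fun c f => by
        simp only [map_smul, RingHom.id_apply]
        exact integral_smul c _ } C fun f => ?_, fun f => ⟨h.integrableOn f, rfl⟩⟩
  change ‖∫ t in Ioo (0 : ℝ) 1, S t f‖ ≤ _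
  refine (norm_integral_le_lintegral_norm _).trans ?_
  simp only [ofReal_norm]
  exact (ENNReal.toReal_mono ENNReal.ofReal_ne_top (hb f)).trans_eq
    (ENNReal.toReal_ofReal (by positivity))

end ConditionW

/-- The bound uses the norms of the `S t` instead of their `EN`; this loses nothing for
multiplication operators by disc algebra functions, where both equal the supremum norm. -/
lemma IsOperatorIntegral.EN_le {S : ℝ → X →L[ℂ] X} {T : X →L[ℂ] X} (hT : IsOperatorIntegral S T) :
    EN T ≤ ∫⁻ t in Ioo (0 : ℝ) 1, ‖S t‖ₑ := by
  refine iSup_le fun f => iSup_le fun hf => iSup_le fun _ => ?_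
  refine limsup_le_of_le (h := Eventually.of_forall fun n => ?_)
  rw [(hT (f n)).2]
  refine (enorm_integral_le_lintegral_enorm _).trans (lintegral_mono fun t => ?_)
  refine ((S t).le_opENorm (f n)).trans ?_
  rw [← ofReal_norm (f n), hf n]
  simp

end Operators

/-! ### Admissible families of measures, evaluations and completeness -/

namespace DiscSpaces

/-- The properties of a family of measures on which the results on `HoloSpace p μ` rest: the
constants have finite norm, nonempty open subsets of the disc have positive norm, discs shrinking
to a boundary point have norms that tend to `0`, and evaluations are locally uniformly bounded. -/
structure Admissible {ι : Type} (p : ℝ≥0∞) (μ : ι → Measure ℂ) : Prop where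
  extNorm_disc : extNorm p μ (disc.indicator 1) < ∞
  extNorm_open : ∀ U : Set ℂ, IsOpen U → U.Nonempty → U ⊆ disc → extNorm p μ (U.indicator 1) ≠ 0
  extNorm_ball : ∀ ξ : ℂ, ‖ξ‖ = 1 →
    Tendsto (fun δ : ℝ => extNorm p μ ((disc ∩ Metric.ball ξ δ).indicator 1)) (𝓝[>] 0) (𝓝 0)
  eval : ∀ r : ℝ, r < 1 → ∃ C : ℝ≥0∞, C ≠ ∞ ∧ ∀ f : ℂ → ℂ, Measurable f →
    DifferentiableOn ℂ f disc → ∀ z ∈ Metric.closedBall (0 : ℂ) r, ‖f z‖ₑ ≤ C * extNorm p μ f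

lemma extNorm_mono {ι : Type} {p : ℝ≥0∞} {μ : ι → Measure ℂ} {f g : ℂ → ℂ}
    (h : ∀ z, ‖f z‖ ≤ ‖g z‖) : extNorm p μ f ≤ extNorm p μ g :=
  iSup_mono fun _ => eLpNorm_mono h

namespace HInfty

variable (g : HInfty)

lemma norm_le_supNorm {z : ℂ} (hz : z ∈ disc) : ‖g z‖ ≤ g.supNorm := by
  obtain ⟨C, hC⟩ := g.bdd
  exact le_ciSup (f := fun z : disc => ‖g z‖) ⟨C, by rintro _ ⟨z, rfl⟩; exact hC z z.2⟩ ⟨z, hz⟩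

lemma supNorm_nonneg : 0 ≤ g.supNorm := Real.iSup_nonneg fun _ => norm_nonneg _

variable {g}

lemma IsDiscAlgebra.norm_le (hg : g.IsDiscAlgebra) {z : ℂ}
    (hz : z ∈ Metric.closedBall (0 : ℂ) 1) : ‖g z‖ ≤ g.supNorm := by
  rw [← closure_ball _ one_ne_zero] at hz
  refine le_on_closure (f := fun z => ‖g z‖) (g := fun _ => g.supNorm)
    (fun w hw => g.norm_le_supNorm hw) ?_ continuousOn_const hz
  rw [closure_ball _ one_ne_zero]
  exact hg.norm

lemma IsDiscAlgebra.exists_norm_eq (hg : g.IsDiscAlgebra) :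
    ∃ ξ : ℂ, ‖ξ‖ = 1 ∧ ‖g ξ‖ = g.supNorm := by
  have hd : DiffContOnCl ℂ g disc :=
    ⟨g.holo, by rw [closure_ball _ one_ne_zero]; exact hg⟩
  obtain ⟨ξ, hξ, hmax⟩ := Complex.exists_mem_frontier_isMaxOn_norm Metric.isBounded_ball
    ⟨0, Metric.mem_ball_self one_pos⟩ hd
  rw [frontier_ball _ one_ne_zero] at hξ
  refine ⟨ξ, by simpa using hξ, le_antisymm (hg.norm_le (Metric.sphere_subset_closedBall hξ)) ?_⟩
  exact Real.iSup_le (fun z : disc => hmax (subset_closure z.2)) (norm_nonneg _)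

end HInfty

namespace HoloSpace

variable {ι : Type} {p : ℝ≥0∞} [Fact (1 ≤ p)] {μ : ι → Measure ℂ}

lemma measurable (f : HoloSpace p μ) : Measurable f := measurable_of_holo f.2.1 f.2.2.1

lemma sub_apply (f g : HoloSpace p μ) (z : ℂ) : (f - g) z = f z - g z := rfl

variable [Separating μ]

lemma enorm_eq (f : HoloSpace p μ) : ‖f‖ₑ = extNorm p μ f := by
  rw [← ofReal_norm]
  exact ENNReal.ofReal_toReal f.2.2.2.ne

lemma norm_mulOp_le (g : HInfty) : ‖(mulOp g : HoloSpace p μ →L[ℂ] HoloSpace p μ)‖ ≤ g.supNorm := by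
  refine ContinuousLinearMap.opNorm_le_bound _ g.supNorm_nonneg fun f => ?_
  have h := extNorm_mul_le p μ (fun z hz => g.norm_le_supNorm hz) f.2.2.1
  refine (ENNReal.toReal_mono
    (ENNReal.mul_lt_top ENNReal.ofReal_lt_top f.2.2.2).ne h).trans_eq ?_
  rw [ENNReal.toReal_mul, ENNReal.toReal_ofReal g.supNorm_nonneg]
  rfl

lemma enorm_mulOp_le (g : HInfty) :
    ‖(mulOp g : HoloSpace p μ →L[ℂ] HoloSpace p μ)‖ₑ ≤ ENNReal.ofReal g.supNorm := by
  rw [← ofReal_norm]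
  exact ENNReal.ofReal_le_ofReal (norm_mulOp_le g)

end HoloSpace

namespace Admissible

open HoloSpace

variable {ι : Type} {p : ℝ≥0∞} [Fact (1 ≤ p)] {μ : ι → Measure ℂ} [Separating μ]

omit [Separating μ] in
lemma exists_norm_apply_le (h : Admissible p μ) {r : ℝ} (hr : r < 1) :
    ∃ C : ℝ, ∀ f : HoloSpace p μ, ∀ z ∈ Metric.closedBall (0 : ℂ) r, ‖f z‖ ≤ C * ‖f‖ := by
  obtain ⟨C, hC, hb⟩ := h.eval r hr
  refine ⟨C.toReal, fun f z hz => ?_⟩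
  have := ENNReal.toReal_mono (ENNReal.mul_ne_top hC f.2.2.2.ne) (hb f f.measurable f.2.1 z hz)
  rwa [toReal_enorm, ENNReal.toReal_mul] at this

/-- Evaluation at a point as a continuous functional. -/
noncomputable def evalCLM (h : Admissible p μ) (z : ℂ) : HoloSpace p μ →L[ℂ] ℂ :=
  LinearMap.mkContinuousOfExistsBound
    { toFun := fun f => f z
      map_add' := fun _ _ => rfl
      map_smul' := fun _ _ => rfl }
    (by
      by_cases hz : z ∈ disc
      · obtain ⟨C, hC⟩ := h.exists_norm_apply_le (show ‖z‖ < 1 by simpa using hz)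
        exact ⟨C, fun f => hC f z (by simp)⟩
      · refine ⟨0, fun f => ?_⟩
        change ‖f z‖ ≤ _
        simp [f.2.2.1 z hz])

lemma evalCLM_apply (h : Admissible p μ) (z : ℂ) (f : HoloSpace p μ) : h.evalCLM z f = f z := rfl

/-- The local bounds on evaluations turn a Cauchy sequence into a locally uniformly convergent one,
so its limit is holomorphic; Fatou's lemma for each measure gives convergence in norm. -/
lemma completeSpace (h : Admissible p μ) : CompleteSpace (HoloSpace p μ) := by
  refine Metric.complete_of_cauchySeq_tendsto fun F hF => ?_
  have hpt : ∀ z, ∃ w, Tendsto (fun n => F n z) atTop (𝓝 w) := fun z =>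
    cauchySeq_tendsto_of_complete ((h.evalCLM z).uniformContinuous.comp_cauchySeq hF)
  choose f hf using hpt
  have hf0 : ∀ z ∉ disc, f z = 0 := fun z hz =>
    tendsto_nhds_unique (hf z) (by simp [fun n => (F n).2.2.1 z hz])
  have hloc : TendstoLocallyUniformlyOn (fun n => (F n : ℂ → ℂ)) f atTop disc := by
    rw [tendstoLocallyUniformlyOn_iff_forall_isCompact Metric.isOpen_ball]
    intro K hK hKc
    obtain ⟨r, hr, hKr⟩ : ∃ r < 1, K ⊆ Metric.closedBall 0 r := by
      rcases K.eq_empty_or_nonempty with rfl | hne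
      · exact ⟨0, one_pos, empty_subset _⟩
      · obtain ⟨w, hw, hmax⟩ := hKc.exists_isMaxOn hne continuous_norm.continuousOn
        exact ⟨‖w‖, by simpa using hK hw, fun z hz => by simpa using hmax hz⟩
    obtain ⟨C, hC⟩ := h.exists_norm_apply_le (p := p) hr
    refine UniformCauchySeqOn.tendstoUniformlyOn_of_tendsto ?_ fun z _ => hf z
    rw [Metric.uniformCauchySeqOn_iff]
    intro ε hε
    obtain ⟨N, hN⟩ := Metric.cauchySeq_iff.1 hF (ε / (|C| + 1)) (by positivity)
    refine ⟨N, fun m hm n hn z hz => ?_⟩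
    have h1 := hC (F m - F n) z (hKr hz)
    have h2 := hN m hm n hn
    rw [dist_eq_norm, lt_div_iff₀ (by positivity)] at h2
    rw [dist_eq_norm, ← HoloSpace.sub_apply]
    nlinarith [le_abs_self C, norm_nonneg (F m - F n)]
  have hdiff : DifferentiableOn ℂ f disc :=
    hloc.differentiableOn (Eventually.of_forall fun n => (F n).2.1) Metric.isOpen_ball
  have hclose : ∀ ε > 0, ∃ N, ∀ n ≥ N, extNorm p μ ((F n : ℂ → ℂ) - f) ≤ ENNReal.ofReal ε := by
    intro ε hε
    obtain ⟨N, hN⟩ := Metric.cauchySeq_iff.1 hF ε hε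
    refine ⟨N, fun n hn => iSup_le fun i => ?_⟩
    refine (Lp.eLpNorm_lim_le_liminf_eLpNorm (f := fun m => (F n : ℂ → ℂ) - (F m : ℂ → ℂ))
      (fun m => ((F n).measurable.sub (F m).measurable).aestronglyMeasurable) _
      (Eventually.of_forall fun z => tendsto_const_nhds.sub (hf z))).trans ?_
    refine liminf_le_of_le (h := fun b hb => ?_)
    obtain ⟨m, hb, hm⟩ := (hb.and (eventually_ge_atTop N)).exists
    refine hb.trans ?_
    have h2 := (hN n hn m hm).le
    rw [dist_eq_norm] at h2
    calc eLpNorm ((F n : ℂ → ℂ) - (F m : ℂ → ℂ)) p (μ i) ≤ extNorm p μ (F n - F m : HoloSpace p μ) :=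
          le_iSup (fun i => eLpNorm ((F n : ℂ → ℂ) - (F m : ℂ → ℂ)) p (μ i)) i
      _ = ‖F n - F m‖ₑ := (enorm_eq _).symm
      _ ≤ ENNReal.ofReal ε := by
          rw [← ofReal_norm]
          exact ENNReal.ofReal_le_ofReal h2
  have hfin : extNorm p μ f < ∞ := by
    obtain ⟨N, hN⟩ := hclose 1 one_pos
    have hfm := measurable_of_holo hdiff hf0
    have h1 : f = (F N : ℂ → ℂ) + (-1 : ℂ) • ((F N : ℂ → ℂ) - f) := by
      ext z
      simp
    rw [h1]
    refine (extNorm_add_le Fact.out μ (F N).measurable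
      (((F N).measurable.sub hfm).const_smul _)).trans_lt (ENNReal.add_lt_top.2 ⟨(F N).2.2.2, ?_⟩)
    rw [extNorm_smul]
    exact ENNReal.mul_lt_top enorm_lt_top ((hN N le_rfl).trans_lt ENNReal.ofReal_lt_top)
  let f' : HoloSpace p μ := ⟨f, hdiff, hf0, hfin⟩
  refine ⟨f', Metric.tendsto_atTop.2 fun ε hε => ?_⟩
  obtain ⟨N, hN⟩ := hclose (ε / 2) (half_pos hε)
  refine ⟨N, fun n hn => ?_⟩
  have h3 : ‖F n - f'‖ₑ ≤ ENNReal.ofReal (ε / 2) := (enorm_eq _).trans_le (hN n hn)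
  rw [← ofReal_norm, ENNReal.ofReal_le_ofReal_iff (half_pos hε).le] at h3
  rw [dist_eq_norm]
  linarith

end Admissible

end DiscSpaces

/-! ### Concentrating sequences and their weak convergence to zero -/

namespace DiscSpaces

/-- For each single measure the p-th powers of norms add over disjoint supports; the supremum over
the family keeps this as an inequality. -/
lemma extNorm_indicator_add_indicator_le {ι : Type} {p : ℝ≥0∞} (hp0 : p ≠ 0) (hp : p ≠ ∞)
    (μ : ι → Measure ℂ) {A : Set ℂ} {u v : ℂ → ℂ} (hu : Measurable u) :
    extNorm p μ (A.indicator u + Aᶜ.indicator v) ≤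
      (extNorm p μ u ^ p.toReal + extNorm p μ v ^ p.toReal) ^ (1 / p.toReal) := by
  have hP : 0 < p.toReal := ENNReal.toReal_pos hp0 hp
  have key : ∀ (f : ℂ → ℂ) (i : ι), ∫⁻ z, ‖f z‖ₑ ^ p.toReal ∂(μ i) ≤ extNorm p μ f ^ p.toReal := by
    intro f i
    have h1 : eLpNorm f p (μ i) ≤ extNorm p μ f := le_iSup (fun i => eLpNorm f p (μ i)) i
    rw [eLpNorm_eq_lintegral_rpow_enorm_toReal hp0 hp] at h1
    rwa [one_div, ENNReal.rpow_inv_le_iff hP] at h1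
  refine iSup_le fun i => ?_
  rw [eLpNorm_eq_lintegral_rpow_enorm_toReal hp0 hp]
  refine ENNReal.rpow_le_rpow ?_ (by positivity)
  refine le_trans ?_ (add_le_add (key u i) (key v i))
  rw [← lintegral_add_left (hu.enorm.pow_const _)]
  refine lintegral_mono fun z => ?_
  by_cases hz : z ∈ A
  · simp [hz]
  · simp [hz]

/-- A sequence of bounded unit vectors whose mass concentrates at the point `ξ`. -/
structure ConcentratesAt {ι : Type} {p : ℝ≥0∞} [Fact (1 ≤ p)] {μ : ι → Measure ℂ} [Separating μ]
    (ξ : ℂ) (f : ℕ → HoloSpace p μ) : Prop where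
  norm_eq_one : ∀ n, ‖f n‖ = 1
  bounded : ∀ n, ∃ M : ℝ, ∀ z, ‖f n z‖ ≤ M
  far : ∀ δ > 0, Tendsto (fun n => extNorm p μ ((Metric.ball ξ δ)ᶜ.indicator (f n))) atTop (𝓝 0)

namespace ConcentratesAt

open HoloSpace

variable {ι : Type} {p : ℝ≥0∞} [Fact (1 ≤ p)] {μ : ι → Measure ℂ} [Separating μ] {ξ : ℂ}
  {f : ℕ → HoloSpace p μ}

lemma extNorm_eq_one (hf : ConcentratesAt ξ f) (n : ℕ) : extNorm p μ (f n) = 1 := by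
  rw [← enorm_eq, ← ofReal_norm, hf.norm_eq_one n, ENNReal.ofReal_one]

/-- Near ξ the factor g - g(ξ) is small by continuity; away from ξ it is at most 2‖g‖_∞ and `f n`
has little mass. -/
lemma tendsto_mulOp_sub (hf : ConcentratesAt ξ f) (hξ : ‖ξ‖ = 1) {g : HInfty}
    (hg : g.IsDiscAlgebra) :
    Tendsto (fun n => ‖mulOp g (f n) - g ξ • f n‖ₑ) atTop (𝓝 0) := by
  have hξm : ξ ∈ Metric.closedBall (0 : ℂ) 1 := by simp [hξ]
  rw [ENNReal.tendsto_nhds_zero]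
  intro ε hε
  obtain ⟨ε', hε', hle⟩ : ∃ ε' : ℝ, 0 < ε' ∧ ENNReal.ofReal ε' ≤ ε / 2 := by
    obtain ⟨a, ha, hb⟩ := ENNReal.lt_iff_exists_nnreal_btwn.1 (ENNReal.half_pos hε.ne')
    exact ⟨a, by simpa using ha, by simpa using hb.le⟩
  obtain ⟨δ, hδ, hclose⟩ := Metric.continuousWithinAt_iff.1 (hg ξ hξm) ε' hε'
  have hfar := (ENNReal.Tendsto.const_mul (a := ENNReal.ofReal (2 * g.supNorm)) (hf.far δ hδ)
    (Or.inr ENNReal.ofReal_ne_top))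
  rw [mul_zero, ENNReal.tendsto_nhds_zero] at hfar
  filter_upwards [hfar (ε / 2) (ENNReal.half_pos hε.ne')] with n hn
  have hsplit : extNorm p μ (mulOp g (f n) - g ξ • f n : HoloSpace p μ) ≤
      extNorm p μ ((ε' : ℂ) • (f n : ℂ → ℂ)) +
      extNorm p μ (((2 * g.supNorm : ℝ) : ℂ) • (Metric.ball ξ δ)ᶜ.indicator (f n)) := by
    have hM : Measurable ((mulOp g (f n) - g ξ • f n : HoloSpace p μ) : ℂ → ℂ) :=
      HoloSpace.measurable _
    have hval : ∀ z, ((mulOp g (f n) - g ξ • f n : HoloSpace p μ) : ℂ → ℂ) z =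
        (g z - g ξ) * f n z := fun z => (sub_mul _ _ _).symm
    generalize ((mulOp g (f n) - g ξ • f n : HoloSpace p μ) : ℂ → ℂ) = u at hM hval
    have h0 : ∀ z ∉ disc, u z = 0 := fun z hz => by rw [hval, (f n).2.2.1 z hz, mul_zero]
    have hB : MeasurableSet (Metric.ball ξ δ) := Metric.isOpen_ball.measurableSet
    rw [← Set.indicator_self_add_compl (Metric.ball ξ δ) u]
    refine (extNorm_add_le Fact.out μ (hM.indicator hB)
      (hM.indicator hB.compl)).trans (add_le_add ?_ ?_) <;> refine extNorm_mono fun z => ?_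
    · by_cases hz : z ∈ disc ∩ Metric.ball ξ δ
      · rw [indicator_of_mem hz.2, hval, norm_mul, Pi.smul_apply, smul_eq_mul, norm_mul]
        refine mul_le_mul_of_nonneg_right ?_ (norm_nonneg _)
        have := (hclose (Metric.ball_subset_closedBall hz.1) hz.2).le
        rw [dist_eq_norm] at this
        simpa [abs_of_pos hε'] using this
      · have : (Metric.ball ξ δ).indicator u z = 0 :=
          indicator_apply_eq_zero.2 fun h => h0 z fun hd => hz ⟨hd, h⟩
        rw [this, norm_zero]
        exact norm_nonneg _
    · by_cases hz : z ∈ (Metric.ball ξ δ)ᶜ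
      · rw [Pi.smul_apply, indicator_of_mem hz, indicator_of_mem hz]
        by_cases hzd : z ∈ disc
        · rw [hval, norm_mul, smul_eq_mul, norm_mul]
          refine mul_le_mul_of_nonneg_right ?_ (norm_nonneg _)
          have h1 := norm_sub_le (g z) (g ξ)
          have h2 := g.norm_le_supNorm hzd
          have h3 := hg.norm_le hξm
          rw [Complex.norm_real, Real.norm_of_nonneg (by linarith [g.supNorm_nonneg])]
          linarith
        · rw [h0 z hzd, norm_zero]
          exact norm_nonneg _
      · rw [indicator_of_notMem hz, norm_zero]
        exact norm_nonneg _
  rw [enorm_eq]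
  refine hsplit.trans ?_
  rw [extNorm_smul, extNorm_smul, hf.extNorm_eq_one, mul_one, ← ofReal_norm, ← ofReal_norm,
    Complex.norm_real, Complex.norm_real, Real.norm_of_nonneg hε'.le,
    Real.norm_of_nonneg (by linarith [g.supNorm_nonneg])]
  exact (add_le_add hle hn).trans_eq (ENNReal.add_halves ε)

/-- A bounded `S` has little mass near ξ and a late `f n` has little mass elsewhere, so their
supports are almost disjoint and the p-th power of the norm grows by hardly more than 1. The choice
of `n` does not depend on the phase `c`. -/
lemma eventually_enorm_add_smul_le (hf : ConcentratesAt ξ f) (hμ : Admissible p μ) (hp : p ≠ ∞)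
    (hξ : ‖ξ‖ = 1) {S : HoloSpace p μ} {M : ℝ} (hM : ∀ z, ‖S z‖ ≤ M) {A B : ℝ≥0∞}
    (hA : ‖S‖ₑ ^ p.toReal ≤ A) (hAB : A + 1 < B) :
    ∀ᶠ n in atTop, ∀ c : ℂ, ‖c‖ = 1 → ‖S + c • f n‖ₑ ^ p.toReal ≤ B := by
  have hp0 : p ≠ 0 := (zero_lt_one.trans_le (Fact.out : 1 ≤ p)).ne'
  have hP : 0 < p.toReal := ENNReal.toReal_pos hp0 hp
  set a := (A + 1) ^ (1 / p.toReal)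
  set b := B ^ (1 / p.toReal)
  have hab : a < b := ENNReal.rpow_lt_rpow hAB (by positivity)
  -- One η pays for the part of `S` near ξ, the other for the part of `f n` away from ξ.
  obtain ⟨η, hη, hηb⟩ : ∃ η > 0, a + η + η ≤ b := by
    refine ⟨(b - a) / 2, ENNReal.half_pos (tsub_pos_of_lt hab).ne', ?_⟩
    rw [add_assoc, ENNReal.add_halves, add_tsub_cancel_of_le hab.le]
  have h1 := ENNReal.Tendsto.const_mul (a := ENNReal.ofReal M) (hμ.extNorm_ball ξ hξ)
    (Or.inr ENNReal.ofReal_ne_top)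
  rw [mul_zero, ENNReal.tendsto_nhds_zero] at h1
  obtain ⟨δ, hδM, hδ⟩ := ((h1 η hη).and self_mem_nhdsWithin).exists
  have hnear : extNorm p μ ((Metric.ball ξ δ).indicator S) ≤ η := by
    refine le_trans ?_ hδM
    rw [show ENNReal.ofReal M = ‖(M : ℂ)‖ₑ by
      rw [← ofReal_norm, Complex.norm_real, Real.norm_of_nonneg ((norm_nonneg _).trans (hM 0))],
      ← extNorm_smul]
    refine extNorm_mono fun z => ?_
    by_cases hz : z ∈ disc ∩ Metric.ball ξ δ
    · rw [indicator_of_mem hz.2, Pi.smul_apply, indicator_of_mem hz]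
      simpa using (hM z).trans (le_abs_self M)
    · have : (Metric.ball ξ δ).indicator S.1 z = 0 :=
        indicator_apply_eq_zero.2 fun h => S.2.2.1 z fun hd => hz ⟨hd, h⟩
      rw [this, norm_zero]
      exact norm_nonneg _
  filter_upwards [(ENNReal.tendsto_nhds_zero.1 (hf.far δ hδ)) η hη] with n hn c hc
  have hB : MeasurableSet (Metric.ball ξ δ) := Metric.isOpen_ball.measurableSet
  have hmS : Measurable (S : ℂ → ℂ) := S.measurable
  have hmf : Measurable (c • (f n : ℂ → ℂ)) := (f n).measurable.const_smul c
  have hsplit : ((S + c • f n : HoloSpace p μ) : ℂ → ℂ) =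
      ((Metric.ball ξ δ)ᶜ.indicator S + (Metric.ball ξ δ)ᶜᶜ.indicator (c • (f n : ℂ → ℂ))) +
        (Metric.ball ξ δ).indicator S + c • (Metric.ball ξ δ)ᶜ.indicator (f n) := by
    ext z
    change S z + c * f n z = _
    by_cases hz : z ∈ Metric.ball ξ δ
    · simp [hz, add_comm]
    · simp [hz]
  have hle : ‖S + c • f n‖ₑ ≤ b := by
    rw [enorm_eq, hsplit]
    refine le_trans ?_ hηb
    refine (extNorm_add_le Fact.out μ (((hmS.indicator hB.compl).add
      (hmf.indicator hB.compl.compl)).add (hmS.indicator hB))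
      (((f n).measurable.indicator hB.compl).const_smul c)).trans (add_le_add ?_ ?_)
    · refine (extNorm_add_le Fact.out μ ((hmS.indicator hB.compl).add
        (hmf.indicator hB.compl.compl)) (hmS.indicator hB)).trans (add_le_add ?_ hnear)
      refine (extNorm_indicator_add_indicator_le hp0 hp μ hmS).trans ?_
      refine ENNReal.rpow_le_rpow (add_le_add ?_ ?_) (by positivity)
      · rwa [← enorm_eq]
      · rw [extNorm_smul, hf.extNorm_eq_one, ← ofReal_norm, hc]
        simp
    · rw [extNorm_smul, ← ofReal_norm, hc]
      simpa using hn
  rwa [← ENNReal.le_rpow_inv_iff hP, ← one_div]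

lemma weaklyNull (hf : ConcentratesAt ξ f) (hμ : Admissible p μ) (h1 : 1 < p) (hp : p ≠ ∞)
    (hξ : ‖ξ‖ = 1) : WeaklyNull f := by
  intro Λ
  have hp0 : p ≠ 0 := (zero_lt_one.trans h1).ne'
  have hP : 1 < p.toReal := by
    rw [← ENNReal.toReal_one]
    exact (ENNReal.toReal_lt_toReal ENNReal.one_ne_top hp).2 h1
  by_contra hcon
  obtain ⟨ε, hε, hfreq⟩ : ∃ ε > 0, ∃ᶠ n in atTop, ε ≤ ‖Λ (f n)‖ := by
    by_contra! h
    refine hcon (Metric.tendsto_nhds.2 fun ε hε => ?_)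
    simpa using h ε hε
  -- `S` is a sum of N unimodular multiples of members of the sequence. Its boundedness is carried
  -- along because the next addition needs it.
  have hS : ∀ N : ℕ, ∃ S : HoloSpace p μ, (∃ M : ℝ, ∀ z, ‖S z‖ ≤ M) ∧
      ‖S‖ₑ ^ p.toReal ≤ 2 * N ∧ N * ε ≤ (Λ S).re := by
    intro N
    induction N with
    | zero =>
      refine ⟨0, ⟨0, fun z => ?_⟩, ?_, ?_⟩
      · change ‖(0 : ℂ)‖ ≤ 0
        simp
      · simp [zero_lt_one.trans hP]
      · simp
    | succ N ih =>
      obtain ⟨S, ⟨M, hM⟩, hSn, hSr⟩ := ih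
      -- Each addition costs about 1; the allowance of 2 provides the strict inequality.
      have hlt : (2 * N + 1 : ℝ≥0∞) < 2 * (N + 1 : ℕ) := by
        exact_mod_cast (by omega : 2 * N + 1 < 2 * (N + 1))
      obtain ⟨n, hn, hn'⟩ := (hfreq.and_eventually
        (hf.eventually_enorm_add_smul_le hμ hp hξ hM hSn hlt)).exists
      have hne : (‖Λ (f n)‖ : ℂ) ≠ 0 := by
        exact_mod_cast (hε.trans_le hn).ne'
      -- The phase that rotates `Λ (f n)` to the positive axis, so that the contributions add up.
      set c : ℂ := (starRingEnd ℂ) (Λ (f n)) / ‖Λ (f n)‖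
      have hc : ‖c‖ = 1 := by
        simp only [c, norm_div, RCLike.norm_conj, Complex.norm_real, norm_norm]
        exact div_self (hε.trans_le hn).ne'
      refine ⟨S + c • f n, ?_, hn' c hc, ?_⟩
      · obtain ⟨M', hM'⟩ := hf.bounded n
        refine ⟨M + M', fun z => ?_⟩
        change ‖S z + c * f n z‖ ≤ _
        refine (norm_add_le _ _).trans (add_le_add (hM z) ?_)
        rw [norm_mul, hc, one_mul]
        exact hM' z
      · have hcΛ : c * Λ (f n) = ‖Λ (f n)‖ := by
          simp only [c]
          rw [div_mul_eq_mul_div, Complex.conj_mul', sq, mul_div_assoc, div_self hne, mul_one]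
        rw [map_add, map_smul, smul_eq_mul, hcΛ, Complex.add_re, Complex.ofReal_re]
        push_cast
        linarith
  have hbound : ∀ N : ℕ, N * ε ≤ ‖Λ‖ * (2 * N : ℝ) ^ (p.toReal)⁻¹ := by
    intro N
    obtain ⟨S, _, hSn, hSr⟩ := hS N
    have h2 : ‖S‖ ≤ (2 * N : ℝ) ^ (p.toReal)⁻¹ := by
      rw [← ENNReal.le_rpow_inv_iff (by linarith)] at hSn
      have := ENNReal.toReal_mono (ENNReal.rpow_ne_top_of_nonneg (by positivity)
        (by exact_mod_cast ENNReal.natCast_ne_top (2 * N))) hSn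
      rw [toReal_enorm, ← ENNReal.toReal_rpow] at this
      simpa using this
    calc N * ε ≤ (Λ S).re := hSr
      _ ≤ ‖Λ S‖ := Complex.re_le_norm _
      _ ≤ ‖Λ‖ * ‖S‖ := Λ.le_opNorm S
      _ ≤ _ := by gcongr
  -- Here p > 1 enters: N ε ≤ ‖Λ‖ (2N)^{1/p} cannot hold for large N.
  have hlim : Tendsto (fun N : ℕ => ((N : ℝ)) ^ (1 - (p.toReal)⁻¹)) atTop atTop :=
    (tendsto_rpow_atTop (sub_pos.2 (inv_lt_one_of_one_lt₀ hP))).comp tendsto_natCast_atTop_atTop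
  obtain ⟨N, hN, hN1⟩ := ((hlim.eventually_gt_atTop
    (‖Λ‖ * 2 ^ (p.toReal)⁻¹ / ε)).and (eventually_ge_atTop 1)).exists
  have hN0 : (0 : ℝ) < N := by exact_mod_cast hN1
  have h3 := hbound N
  rw [div_lt_iff₀ hε] at hN
  rw [Real.mul_rpow (by norm_num) hN0.le] at h3
  have h4 : (N : ℝ) = (N : ℝ) ^ (1 - (p.toReal)⁻¹) * (N : ℝ) ^ (p.toReal)⁻¹ := by
    rw [← Real.rpow_add hN0]
    simp
  have h5 : (0 : ℝ) < (N : ℝ) ^ (p.toReal)⁻¹ := Real.rpow_pos_of_pos hN0 _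
  have h6 := mul_lt_mul_of_pos_right hN h5
  rw [mul_right_comm (_ ^ _) ε, ← h4] at h6
  linarith

end ConcentratesAt

end DiscSpaces

/-! ### Peak functions and the construction of concentrating sequences -/

namespace DiscSpaces

section Peak

/-- The function `(1 + ξ̄ z) / 2`, which peaks at `ξ`. -/
noncomputable def peakFun (ξ z : ℂ) : ℂ := (1 + (starRingEnd ℂ) ξ * z) / 2

lemma differentiable_peakFun (ξ : ℂ) : Differentiable ℂ (peakFun ξ) := by
  unfold peakFun
  fun_prop

variable {ξ : ℂ}

lemma conj_mul_self_of_norm_eq_one (hξ : ‖ξ‖ = 1) : (starRingEnd ℂ) ξ * ξ = 1 := by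
  rw [Complex.conj_mul', hξ]
  simp

/-- The parallelogram law for 1 and ξ̄z, where |1 - ξ̄z| = |ξ - z|. -/
lemma norm_peakFun_sq_le (hξ : ‖ξ‖ = 1) {z : ℂ} (hz : z ∈ disc) :
    ‖peakFun ξ z‖ ^ 2 ≤ 1 - dist z ξ ^ 2 / 4 := by
  have h1 := parallelogram_law_with_norm ℝ (1 : ℂ) ((starRingEnd ℂ) ξ * z)
  have h2 : 1 - (starRingEnd ℂ) ξ * z = (starRingEnd ℂ) ξ * (ξ - z) := by
    rw [mul_sub, conj_mul_self_of_norm_eq_one hξ]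
  have hz' : ‖z‖ < 1 := by simpa using hz
  rw [h2, norm_mul, norm_mul, RCLike.norm_conj, hξ, norm_one] at h1
  rw [peakFun, norm_div, dist_comm, dist_eq_norm, Complex.norm_two, div_pow]
  nlinarith [norm_nonneg z]

lemma norm_peakFun_le_one (hξ : ‖ξ‖ = 1) {z : ℂ} (hz : z ∈ disc) : ‖peakFun ξ z‖ ≤ 1 := by
  have h1 := norm_peakFun_sq_le hξ hz
  nlinarith [sq_nonneg (dist z ξ), norm_nonneg (peakFun ξ z)]

lemma exists_norm_peakFun_le (hξ : ‖ξ‖ = 1) {δ : ℝ} (hδ : 0 < δ) :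
    ∃ q, 0 ≤ q ∧ q < 1 ∧ ∀ z ∈ disc, z ∉ Metric.ball ξ δ → ‖peakFun ξ z‖ ≤ q := by
  refine ⟨√(1 - δ ^ 2 / 4), Real.sqrt_nonneg _, ?_, fun z hz hzδ => ?_⟩
  · rw [Real.sqrt_lt' one_pos]
    have : 0 < δ ^ 2 := by positivity
    linarith
  · refine (le_abs_self _).trans (Real.abs_le_sqrt ?_)
    have h1 := norm_peakFun_sq_le hξ hz
    have h2 : δ ≤ dist z ξ := by simpa using hzδ
    nlinarith

lemma nonempty_lt_norm_peakFun (hξ : ‖ξ‖ = 1) {q : ℝ} (hq0 : 0 ≤ q) (hq : q < 1) :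
    (disc ∩ {z | q < ‖peakFun ξ z‖}).Nonempty := by
  -- At qξ the peak function equals (1 + q)/2, which exceeds q.
  refine ⟨q * ξ, by simpa [hξ, abs_of_nonneg hq0] using hq, ?_⟩
  have h1 : peakFun ξ (q * ξ) = ((1 + q) / 2 : ℝ) := by
    rw [peakFun, mul_left_comm, conj_mul_self_of_norm_eq_one hξ]
    push_cast
    ring
  rw [mem_ofPred_eq, h1, Complex.norm_real, Real.norm_of_nonneg (by linarith)]
  linarith

/-- The powers of the peaking function. -/
noncomputable def peakPow (hξ : ‖ξ‖ = 1) (n : ℕ) : HInfty where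
  toFun z := peakFun ξ z ^ n
  holo := ((differentiable_peakFun ξ).pow n).differentiableOn
  bdd := ⟨1, fun z hz => by
    rw [norm_pow]
    exact pow_le_one₀ (norm_nonneg _) (norm_peakFun_le_one hξ hz)⟩

end Peak

namespace Admissible

open HoloSpace

variable {ι : Type} {p : ℝ≥0∞} [Fact (1 ≤ p)] {μ : ι → Measure ℂ}

/-- The constant function `1`. -/
noncomputable def one (hμ : Admissible p μ) : HoloSpace p μ :=
  ⟨disc.indicator 1, (differentiableOn_const (1 : ℂ)).congr fun _ hz => indicator_of_mem hz _,
    fun _ hz => indicator_of_notMem hz _, hμ.extNorm_disc⟩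

lemma one_apply (hμ : Admissible p μ) {z : ℂ} (hz : z ∈ disc) : hμ.one z = 1 :=
  indicator_of_mem hz _

omit [Fact (1 ≤ p)] in
lemma extNorm_lt_norm_peakFun_ne_zero (hμ : Admissible p μ) {ξ : ℂ} (hξ : ‖ξ‖ = 1) {q : ℝ}
    (hq0 : 0 ≤ q) (hq : q < 1) :
    extNorm p μ ((disc ∩ {z | q < ‖peakFun ξ z‖}).indicator 1) ≠ 0 :=
  hμ.extNorm_open _ (Metric.isOpen_ball.inter
    (isOpen_lt continuous_const (differentiable_peakFun ξ).continuous.norm))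
    (nonempty_lt_norm_peakFun hξ hq0 hq) inter_subset_left

variable [Separating μ]

/-- The set on the left is open and nonempty if q < 1, so its norm is nonzero: the norms of the
powers decay more slowly than any geometric rate below 1. -/
lemma mul_le_enorm_peakPow (hμ : Admissible p μ) {ξ : ℂ} (hξ : ‖ξ‖ = 1) {q : ℝ} (hq : 0 ≤ q)
    (n : ℕ) :
    ENNReal.ofReal (q ^ n) * extNorm p μ ((disc ∩ {z | q < ‖peakFun ξ z‖}).indicator 1) ≤
      ‖mulOp (peakPow hξ n) hμ.one‖ₑ := by
  have h1 : ENNReal.ofReal (q ^ n) = ‖((q ^ n : ℝ) : ℂ)‖ₑ := by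
    rw [← ofReal_norm, Complex.norm_real, Real.norm_of_nonneg (by positivity)]
  rw [enorm_eq, h1, ← extNorm_smul]
  refine extNorm_mono fun z => ?_
  by_cases hz : z ∈ disc ∩ {z | q < ‖peakFun ξ z‖}
  · rw [Pi.smul_apply, indicator_of_mem hz, mulOp_apply, hμ.one_apply hz.1]
    change _ ≤ ‖peakFun ξ z ^ n * 1‖
    rw [smul_eq_mul, Pi.one_apply, mul_one, mul_one, norm_pow, Complex.norm_real,
      Real.norm_of_nonneg (by positivity)]
    exact pow_le_pow_left₀ hq hz.2.le n
  · rw [Pi.smul_apply, indicator_of_notMem hz, smul_zero, norm_zero]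
    exact norm_nonneg _

lemma norm_peakPow_pos (hμ : Admissible p μ) {ξ : ℂ} (hξ : ‖ξ‖ = 1) (n : ℕ) :
    0 < ‖mulOp (peakPow hξ n) hμ.one‖ := by
  have h1 := hμ.mul_le_enorm_peakPow hξ (q := 1 / 2) (by norm_num) n
  have h2 := hμ.extNorm_lt_norm_peakFun_ne_zero hξ (q := 1 / 2) (by norm_num) (by norm_num)
  have h3 : ‖mulOp (peakPow hξ n) hμ.one‖ₑ ≠ 0 := by
    refine (lt_of_lt_of_le ?_ h1).ne'
    exact ENNReal.mul_pos (by simp) h2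
  rw [norm_pos_iff]
  exact enorm_ne_zero.1 h3

lemma exists_concentratesAt (hμ : Admissible p μ) {ξ : ℂ} (hξ : ‖ξ‖ = 1) :
    ∃ f : ℕ → HoloSpace p μ, ConcentratesAt ξ f := by
  set K : ℕ → HoloSpace p μ := fun n => mulOp (peakPow hξ n) hμ.one
  have hpos : ∀ n, 0 < ‖K n‖ := hμ.norm_peakPow_pos hξ
  have hval : ∀ n z, z ∈ disc → K n z = peakFun ξ z ^ n := fun n z hz => by
    change peakFun ξ z ^ n * hμ.one z = _
    rw [hμ.one_apply hz, mul_one]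
  refine ⟨fun n => ((‖K n‖⁻¹ : ℝ) : ℂ) • K n, ⟨fun n => ?_, fun n => ⟨‖K n‖⁻¹, fun z => ?_⟩,
    fun δ hδ => ?_⟩⟩
  · rw [norm_smul, Complex.norm_real, norm_inv, norm_norm, inv_mul_cancel₀ (hpos n).ne']
  · change ‖((‖K n‖⁻¹ : ℝ) : ℂ) * K n z‖ ≤ _
    rw [norm_mul, Complex.norm_real, norm_inv, norm_norm]
    refine mul_le_of_le_one_right (inv_nonneg.2 (norm_nonneg _)) ?_
    by_cases hz : z ∈ disc
    · rw [hval n z hz, norm_pow]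
      exact pow_le_one₀ (norm_nonneg _) (norm_peakFun_le_one hξ hz)
    · rw [(K n).2.2.1 z hz, norm_zero]
      exact zero_le_one
  · obtain ⟨q, hq0, hq1, hq⟩ := exists_norm_peakFun_le hξ hδ
    -- Off the ball the n-th power has norm at most q^n m, while its full norm is at least s^n c.
    -- After normalisation the far part is therefore O((q/s)^n).
    obtain ⟨s, hqs, hs1⟩ := exists_between hq1
    have hs0 : 0 < s := hq0.trans_lt hqs
    set m := extNorm p μ (disc.indicator 1)
    set c := extNorm p μ ((disc ∩ {z | s < ‖peakFun ξ z‖}).indicator 1)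
    have hc : c ≠ 0 := hμ.extNorm_lt_norm_peakFun_ne_zero hξ hs0.le hs1
    have hcT : c ≠ ∞ := by
      refine ((extNorm_mono fun z => ?_).trans_lt hμ.extNorm_disc).ne
      exact norm_indicator_le_of_subset inter_subset_left _ _
    have hfar : ∀ n, extNorm p μ ((Metric.ball ξ δ)ᶜ.indicator (K n)) ≤
        ENNReal.ofReal (q ^ n) * m := by
      intro n
      have h1 : ENNReal.ofReal (q ^ n) = ‖((q ^ n : ℝ) : ℂ)‖ₑ := by
        rw [← ofReal_norm, Complex.norm_real, Real.norm_of_nonneg (by positivity)]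
      rw [h1, ← extNorm_smul]
      refine extNorm_mono fun z => ?_
      by_cases hz : z ∈ disc ∧ z ∉ Metric.ball ξ δ
      · rw [indicator_of_mem (by exact hz.2), hval n z hz.1, Pi.smul_apply, indicator_of_mem hz.1,
          smul_eq_mul, Pi.one_apply, mul_one, norm_pow, Complex.norm_real,
          Real.norm_of_nonneg (by positivity)]
        exact pow_le_pow_left₀ (norm_nonneg _) (hq z hz.1 hz.2) n
      · have : (Metric.ball ξ δ)ᶜ.indicator (K n).1 z = 0 :=
          indicator_apply_eq_zero.2 fun h => (K n).2.2.1 z fun hd => hz ⟨hd, h⟩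
        rw [this, norm_zero]
        exact norm_nonneg _
    have hle : ∀ n, extNorm p μ ((Metric.ball ξ δ)ᶜ.indicator
        ((((‖K n‖⁻¹ : ℝ) : ℂ) • K n : HoloSpace p μ) : ℂ → ℂ)) ≤
        ENNReal.ofReal ((q / s) ^ n) * (m * c⁻¹) := by
      intro n
      have h1 : (Metric.ball ξ δ)ᶜ.indicator
          ((((‖K n‖⁻¹ : ℝ) : ℂ) • K n : HoloSpace p μ) : ℂ → ℂ) =
          ((‖K n‖⁻¹ : ℝ) : ℂ) • (Metric.ball ξ δ)ᶜ.indicator (K n) :=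
        indicator_const_smul (Metric.ball ξ δ)ᶜ ((‖K n‖⁻¹ : ℝ) : ℂ) (K n).1
      have h2 : ‖((‖K n‖⁻¹ : ℝ) : ℂ)‖ₑ = ‖K n‖ₑ⁻¹ := by
        rw [← ofReal_norm, Complex.norm_real, norm_inv, norm_norm,
          ENNReal.ofReal_inv_of_pos (hpos n), ofReal_norm]
      have h3 := ENNReal.inv_le_inv.2 (hμ.mul_le_enorm_peakPow hξ hs0.le n)
      rw [ENNReal.mul_inv (Or.inr hcT) (Or.inr hc),
        ← ENNReal.ofReal_inv_of_pos (by positivity)] at h3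
      rw [h1, extNorm_smul, h2]
      refine (mul_le_mul' h3 (hfar n)).trans_eq ?_
      rw [div_pow, div_eq_mul_inv (q ^ n), ENNReal.ofReal_mul (by positivity)]
      ring
    have hlim : Tendsto (fun n : ℕ => ENNReal.ofReal ((q / s) ^ n) * (m * c⁻¹)) atTop
        (𝓝 0) := by
      have h1 : Tendsto (fun n : ℕ => (q / s) ^ n) atTop (𝓝 0) :=
        tendsto_pow_atTop_nhds_zero_of_lt_one (by positivity)
          ((div_lt_one hs0).2 hqs)
      have h2 := ENNReal.Tendsto.mul_const (b := m * c⁻¹) (ENNReal.tendsto_ofReal h1)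
        (Or.inr (ENNReal.mul_ne_top hμ.extNorm_disc.ne (ENNReal.inv_ne_top.2 hc)))
      simpa using h2
    exact tendsto_of_tendsto_of_tendsto_of_le_of_le tendsto_const_nhds hlim
      (fun _ => zero_le) hle

end Admissible

end DiscSpaces

/-! ### `EN` of multiplication operators and of their integral -/

namespace DiscSpaces

open HoloSpace

variable {ι : Type} {p : ℝ≥0∞} [Fact (1 ≤ p)] {μ : ι → Measure ℂ} [Separating μ]

lemma ConcentratesAt.tendsto_enorm {ξ : ℂ} {f : ℕ → HoloSpace p μ} (hf : ConcentratesAt ξ f)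
    {S : HoloSpace p μ →L[ℂ] HoloSpace p μ} {c : ℂ}
    (h : Tendsto (fun n => ‖S (f n) - c • f n‖ₑ) atTop (𝓝 0)) :
    Tendsto (fun n => ‖S (f n)‖ₑ) atTop (𝓝 ‖c‖ₑ) := by
  have h1 : Tendsto (fun n => S (f n) - c • f n) atTop (𝓝 0) :=
    tendsto_zero_iff_enorm_tendsto_zero.2 h
  have h2 : Tendsto (fun n => ‖S (f n)‖ - ‖c‖) atTop (𝓝 0) := by
    refine squeeze_zero_norm (fun n => ?_) (tendsto_zero_iff_norm_tendsto_zero.1 h1)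
    have h3 : ‖c • f n‖ = ‖c‖ := by rw [norm_smul, hf.norm_eq_one n, mul_one]
    rw [← h3]
    exact abs_norm_sub_norm_le _ _
  have h3 : Tendsto (fun n => ‖S (f n)‖) atTop (𝓝 ‖c‖) := by
    simpa using h2.add_const ‖c‖
  simpa only [ofReal_norm] using ENNReal.tendsto_ofReal h3

namespace Admissible

lemma EN_mulOp (hμ : Admissible p μ) (h1 : 1 < p) (hp : p ≠ ∞) {g : HInfty}
    (hg : g.IsDiscAlgebra) :
    EN (mulOp g : HoloSpace p μ →L[ℂ] HoloSpace p μ) = ENNReal.ofReal g.supNorm := by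
  refine le_antisymm ((EN_le_enorm _).trans (enorm_mulOp_le g)) ?_
  obtain ⟨ξ, hξ, hgξ⟩ := hg.exists_norm_eq
  obtain ⟨f, hf⟩ := hμ.exists_concentratesAt (p := p) hξ
  rw [← hgξ, ofReal_norm]
  exact le_EN hf.norm_eq_one (hf.weaklyNull hμ h1 hp hξ)
    (hf.tendsto_enorm (hf.tendsto_mulOp_sub hξ hg))

variable {g : ℝ → HInfty}

lemma continuousOn_apply (hμ : Admissible p μ)
    (hW : ConditionW (fun t => (mulOp (g t) : HoloSpace p μ →L[ℂ] HoloSpace p μ))) {z : ℂ}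
    (hz : z ∈ disc) : ContinuousOn (fun t => g t z) (Ioo 0 1) := by
  refine ((hμ.evalCLM z).continuous.comp_continuousOn (hW.continuousOn hμ.one)).congr fun t _ => ?_
  change g t z = g t z * hμ.one z
  rw [hμ.one_apply hz, mul_one]

/-- Condition W gives continuity in t only at interior points; a boundary value is a limit of
interior values. -/
lemma aestronglyMeasurable_apply (hμ : Admissible p μ)
    (hg : ∀ t ∈ Ioo (0 : ℝ) 1, (g t).IsDiscAlgebra)
    (hW : ConditionW (fun t => (mulOp (g t) : HoloSpace p μ →L[ℂ] HoloSpace p μ))) {z : ℂ}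
    (hz : z ∈ Metric.closedBall (0 : ℂ) 1) :
    AEStronglyMeasurable (fun t => g t z) (volume.restrict (Ioo (0 : ℝ) 1)) := by
  have hz' : z ∈ closure disc := by rwa [closure_ball _ one_ne_zero]
  obtain ⟨w, hw, hlim⟩ := mem_closure_iff_seq_limit.1 hz'
  refine aestronglyMeasurable_of_tendsto_ae atTop (f := fun n t => g t (w n))
    (fun n => (hμ.continuousOn_apply hW (hw n)).aestronglyMeasurable measurableSet_Ioo)
    (ae_restrict_of_forall_mem measurableSet_Ioo fun t ht => ?_)
  exact (hg t ht z hz).tendsto.comp (tendsto_nhdsWithin_iff.2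
    ⟨hlim, Eventually.of_forall fun n => Metric.ball_subset_closedBall (hw n)⟩)

/-- The supremum may be taken over a countable dense subset of the disc. -/
lemma aemeasurable_supNorm (hμ : Admissible p μ)
    (hW : ConditionW (fun t => (mulOp (g t) : HoloSpace p μ →L[ℂ] HoloSpace p μ))) :
    AEMeasurable (fun t => (g t).supNorm) (volume.restrict (Ioo (0 : ℝ) 1)) := by
  have : Nonempty disc := ⟨⟨0, Metric.mem_ball_self one_pos⟩⟩
  have h1 : (fun t => (g t).supNorm) = fun t => ⨆ n, ‖g t (TopologicalSpace.denseSeq disc n)‖ := by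
    ext t
    have hb : BddAbove (range fun n => ‖g t (TopologicalSpace.denseSeq disc n)‖) :=
      ⟨(g t).supNorm, by rintro _ ⟨n, rfl⟩; exact (g t).norm_le_supNorm (Subtype.prop _)⟩
    refine le_antisymm (Real.iSup_le (fun z => ?_) (Real.iSup_nonneg fun n => norm_nonneg _))
      (Real.iSup_le (fun n => (g t).norm_le_supNorm (Subtype.prop _)) (g t).supNorm_nonneg)
    have hcl : IsClosed {z : disc | ‖g t z‖ ≤ ⨆ n, ‖g t (TopologicalSpace.denseSeq disc n)‖} :=
      isClosed_le ((continuousOn_iff_continuous_domRestrict.1 (g t).holo.continuousOn).norm)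
        continuous_const
    exact (TopologicalSpace.denseRange_denseSeq disc).induction_on z hcl
      fun n => le_ciSup hb n
  rw [h1]
  exact AEMeasurable.iSup fun n => ((hμ.continuousOn_apply hW
    (Subtype.prop _)).aestronglyMeasurable measurableSet_Ioo).norm.aemeasurable

variable {T : HoloSpace p μ →L[ℂ] HoloSpace p μ}

/-- Evaluation is a continuous functional, so it commutes with the Bochner integral. -/
lemma operatorIntegral_apply (hμ : Admissible p μ)
    (hT : IsOperatorIntegral (fun t => mulOp (g t)) T) (f : HoloSpace p μ) (z : ℂ) :
    T f z = (∫ t in Ioo (0 : ℝ) 1, g t z) * f z := by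
  have := hμ.completeSpace (p := p)
  rw [← hμ.evalCLM_apply, (hT f).2, ← ContinuousLinearMap.integral_comp_comm _ (hT f).1,
    ← integral_mul_const]
  rfl

lemma lintegral_supNorm_le_EN_of_peak (hμ : Admissible p μ) (h1 : 1 < p) (hp : p ≠ ∞)
    (hg : ∀ t ∈ Ioo (0 : ℝ) 1, (g t).IsDiscAlgebra)
    (hW : ConditionW (fun t => (mulOp (g t) : HoloSpace p μ →L[ℂ] HoloSpace p μ)))
    (hT : IsOperatorIntegral (fun t => mulOp (g t)) T) {ξ θ : ℂ} (hξ : ‖ξ‖ = 1) (hθ : ‖θ‖ = 1)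
    (h : ∀ᵐ t ∂(volume.restrict (Ioo (0 : ℝ) 1)), θ * g t ξ = ((g t).supNorm : ℂ)) :
    ∫⁻ t in Ioo (0 : ℝ) 1, ENNReal.ofReal (g t).supNorm ≤ EN T := by
  have := hμ.completeSpace (p := p)
  obtain ⟨f, hf⟩ := hμ.exists_concentratesAt (p := p) hξ
  have hnorm : ∀ᵐ t ∂(volume.restrict (Ioo (0 : ℝ) 1)),
      ENNReal.ofReal (g t).supNorm = ‖g t ξ‖ₑ := by
    filter_upwards [h] with t ht
    have h2 := congrArg norm ht
    rw [norm_mul, hθ, one_mul, Complex.norm_real, Real.norm_of_nonneg (g t).supNorm_nonneg] at h2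
    rw [← h2, ofReal_norm]
  have hlim : ∀ t ∈ Ioo (0 : ℝ) 1, Tendsto (fun n => ‖mulOp (g t) (f n) - g t ξ • f n‖ₑ) atTop
      (𝓝 0) := fun t ht => hf.tendsto_mulOp_sub hξ (hg t ht)
  obtain ⟨C, hC, hb⟩ := hW.exists_lintegral_le
  -- Condition W concerns one f at a time. Finiteness here comes from Fatou's lemma, as ‖M_{g_t}
  -- f_n‖ → |g_t(ξ)| = ‖g_t‖_∞ and the integrals over t are at most C for unit vectors.
  have hfin : ∫⁻ t in Ioo (0 : ℝ) 1, ENNReal.ofReal (g t).supNorm ≠ ∞ := by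
    refine ne_top_of_le_ne_top (b := ENNReal.ofReal C) ENNReal.ofReal_ne_top ?_
    calc ∫⁻ t in Ioo (0 : ℝ) 1, ENNReal.ofReal (g t).supNorm
        = ∫⁻ t in Ioo (0 : ℝ) 1, liminf (fun n => ‖mulOp (g t) (f n)‖ₑ) atTop := by
          refine lintegral_congr_ae ?_
          filter_upwards [hnorm, ae_restrict_mem measurableSet_Ioo] with t ht htI
          rw [ht, (hf.tendsto_enorm (hlim t htI)).liminf_eq]
      _ ≤ liminf (fun n => ∫⁻ t in Ioo (0 : ℝ) 1, ‖mulOp (g t) (f n)‖ₑ) atTop :=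
          lintegral_liminf_le' fun n => (hW.aestronglyMeasurable (f n)).enorm
      _ ≤ ENNReal.ofReal C := by
          refine liminf_le_of_le (h := fun b hb' => ?_)
          obtain ⟨n, hn⟩ := hb'.exists
          refine hn.trans ((hb (f n)).trans ?_)
          rw [hf.norm_eq_one, mul_one]
  have hmeas := hμ.aestronglyMeasurable_apply hg hW
    (Metric.sphere_subset_closedBall (show ξ ∈ Metric.sphere 0 1 by simpa using hξ))
  have hint : IntegrableOn (fun t => g t ξ) (Ioo (0 : ℝ) 1) := by
    refine ⟨hmeas, ?_⟩
    rw [HasFiniteIntegral, ← lintegral_congr_ae hnorm]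
    exact hfin.lt_top
  set c := ∫ t in Ioo (0 : ℝ) 1, g t ξ
  have hc : ∫⁻ t in Ioo (0 : ℝ) 1, ENNReal.ofReal (g t).supNorm = ‖c‖ₑ := by
    have hm : Integrable (fun t => (g t).supNorm) (volume.restrict (Ioo (0 : ℝ) 1)) := by
      refine ⟨(hμ.aemeasurable_supNorm hW).aestronglyMeasurable, ?_⟩
      rw [hasFiniteIntegral_iff_ofReal (Eventually.of_forall fun t => (g t).supNorm_nonneg)]
      exact hfin.lt_top
    rw [← ofReal_integral_eq_lintegral_ofReal hm
      (Eventually.of_forall fun t => (g t).supNorm_nonneg)]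
    have h2 : θ * c = ((∫ t in Ioo (0 : ℝ) 1, (g t).supNorm : ℝ) : ℂ) := by
      rw [← integral_const_mul]
      exact (integral_congr_ae h).trans integral_ofReal
    have h3 := congrArg norm h2
    rw [norm_mul, hθ, one_mul, Complex.norm_real,
      Real.norm_of_nonneg (integral_nonneg fun t => (g t).supNorm_nonneg)] at h3
    rw [← h3, ofReal_norm]
  rw [hc]
  refine le_EN hf.norm_eq_one (hf.weaklyNull hμ h1 hp hξ) (hf.tendsto_enorm ?_)
  have hsub : ∀ n, T (f n) - c • f n =
      ∫ t in Ioo (0 : ℝ) 1, (mulOp (g t) (f n) - g t ξ • f n) := fun n => by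
    rw [integral_sub (hT (f n)).1 (hint.smul_const _), integral_smul_const, ← (hT (f n)).2]
  -- Dominated convergence with majorant 2‖g_t‖_∞ transfers the asymptotics on `f n` from each
  -- M_{g_t} to `T`.
  have hdom : Tendsto (fun n => ∫⁻ t in Ioo (0 : ℝ) 1, ‖mulOp (g t) (f n) - g t ξ • f n‖ₑ) atTop
      (𝓝 (∫⁻ _ in Ioo (0 : ℝ) 1, 0)) := by
    refine tendsto_lintegral_of_dominated_convergence'
      (fun t => 2 * ENNReal.ofReal (g t).supNorm) (fun n => ?_) (fun n => ?_) ?_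
      (ae_restrict_of_forall_mem measurableSet_Ioo hlim)
    · exact ((hW.aestronglyMeasurable (f n)).sub (hmeas.smul_const _)).enorm
    · filter_upwards [hnorm] with t ht
      refine (enorm_sub_le).trans ?_
      have hfn : ‖f n‖ₑ = 1 := by rw [← ofReal_norm, hf.norm_eq_one, ENNReal.ofReal_one]
      rw [two_mul]
      refine add_le_add ?_ ?_
      · refine ((mulOp (g t)).le_opENorm (f n)).trans ?_
        rw [hfn, mul_one]
        exact enorm_mulOp_le (g t)
      · rw [enorm_smul, hfn, mul_one, ht]
    · rw [lintegral_const_mul' _ _ ENNReal.ofNat_ne_top]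
      exact ENNReal.mul_ne_top ENNReal.ofNat_ne_top hfin
  rw [lintegral_zero] at hdom
  refine tendsto_of_tendsto_of_tendsto_of_le_of_le tendsto_const_nhds hdom (fun _ => zero_le)
    fun n => ?_
  rw [hsub]
  exact enorm_integral_le_lintegral_enorm _

/-- The point ξ is a maximum point of |G| on the circle and θ is the phase that makes θ G(ξ)
nonnegative. -/
lemma exists_peak_of_le_EN (hμ : Admissible p μ)
    (hg : ∀ t ∈ Ioo (0 : ℝ) 1, (g t).IsDiscAlgebra)
    (hW : ConditionW (fun t => (mulOp (g t) : HoloSpace p μ →L[ℂ] HoloSpace p μ)))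
    (hT : IsOperatorIntegral (fun t => mulOp (g t)) T)
    (h : ∫⁻ t in Ioo (0 : ℝ) 1, ENNReal.ofReal (g t).supNorm ≤ EN T) :
    ∃ ξ θ : ℂ, ‖ξ‖ = 1 ∧ ‖θ‖ = 1 ∧
      ∀ᵐ t ∂(volume.restrict (Ioo (0 : ℝ) 1)), θ * g t ξ = ((g t).supNorm : ℂ) := by
  -- The hypothesis bounds the integral by `EN T`, hence by the finite norm of `T`.
  have hm : Integrable (fun t => (g t).supNorm) (volume.restrict (Ioo (0 : ℝ) 1)) := by
    refine ⟨(hμ.aemeasurable_supNorm hW).aestronglyMeasurable, ?_⟩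
    rw [hasFiniteIntegral_iff_ofReal (Eventually.of_forall fun t => (g t).supNorm_nonneg)]
    exact (h.trans (EN_le_enorm T)).trans_lt enorm_lt_top
  set G : ℂ → ℂ := fun z => ∫ t in Ioo (0 : ℝ) 1, g t z
  have hcont : ContinuousOn G (Metric.closedBall 0 1) := by
    refine continuousOn_of_dominated (bound := fun t => (g t).supNorm)
      (fun z hz => hμ.aestronglyMeasurable_apply hg hW hz) (fun z hz => ?_) hm ?_
    · exact ae_restrict_of_forall_mem measurableSet_Ioo fun t ht => (hg t ht).norm_le hz
    · exact ae_restrict_of_forall_mem measurableSet_Ioo fun t ht => hg t ht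
  have hholo : DifferentiableOn ℂ G disc := by
    refine (T hμ.one).2.1.congr fun z hz => ?_
    rw [hμ.operatorIntegral_apply hT, hμ.one_apply hz, mul_one]
  obtain ⟨ξ, hξ, hmax⟩ := Complex.exists_mem_frontier_isMaxOn_norm Metric.isBounded_ball
    ⟨0, Metric.mem_ball_self one_pos⟩
    (show DiffContOnCl ℂ G disc from ⟨hholo, by rwa [closure_ball _ one_ne_zero]⟩)
  rw [frontier_ball _ one_ne_zero] at hξ
  have hENG : EN T ≤ ‖G ξ‖ₑ := by
    refine (EN_le_enorm T).trans ?_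
    rw [enorm_le_iff_norm_le]
    refine ContinuousLinearMap.opNorm_le_bound _ (norm_nonneg _) fun f => ?_
    rw [← norm_smul, ← enorm_le_iff_norm_le, enorm_eq, enorm_eq]
    refine extNorm_mono fun z => ?_
    rw [hμ.operatorIntegral_apply hT]
    change ‖G z * f z‖ ≤ ‖G ξ * f z‖
    by_cases hz : z ∈ disc
    · rw [norm_mul, norm_mul]
      exact mul_le_mul_of_nonneg_right (hmax (subset_closure hz)) (norm_nonneg _)
    · rw [f.2.2.1 z hz, mul_zero, mul_zero]
  have hle : ∫ t in Ioo (0 : ℝ) 1, (g t).supNorm ≤ ‖G ξ‖ := by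
    have h2 := h.trans hENG
    rwa [← ofReal_integral_eq_lintegral_ofReal hm
      (Eventually.of_forall fun t => (g t).supNorm_nonneg), ← ofReal_norm,
      ENNReal.ofReal_le_ofReal_iff (norm_nonneg _)] at h2
  have hξc := Metric.sphere_subset_closedBall hξ
  obtain ⟨θ, hθ, hθG⟩ : ∃ θ : ℂ, ‖θ‖ = 1 ∧ θ * G ξ = ‖G ξ‖ := by
    by_cases h0 : G ξ = 0
    · exact ⟨1, norm_one, by simp [h0]⟩
    · have h1 : (‖G ξ‖ : ℂ) ≠ 0 := by simpa using h0
      refine ⟨(starRingEnd ℂ) (G ξ) / ‖G ξ‖, ?_, ?_⟩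
      · rw [norm_div, RCLike.norm_conj, Complex.norm_real, norm_norm,
          div_self (norm_ne_zero_iff.2 h0)]
      · rw [div_mul_eq_mul_div, Complex.conj_mul', sq, mul_div_assoc, div_self h1, mul_one]
  refine ⟨ξ, θ, by simpa using hξ, hθ, ?_⟩
  have hint : Integrable (fun t => g t ξ) (volume.restrict (Ioo (0 : ℝ) 1)) :=
    hm.mono' (hμ.aestronglyMeasurable_apply hg hW hξc)
      (ae_restrict_of_forall_mem measurableSet_Ioo fun t ht => (hg t ht).norm_le hξc)
  have hnorm : ∀ t ∈ Ioo (0 : ℝ) 1, ‖θ * g t ξ‖ ≤ (g t).supNorm := fun t ht => by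
    rw [norm_mul, hθ, one_mul]
    exact (hg t ht).norm_le hξc
  have hre : ∫ t in Ioo (0 : ℝ) 1, (θ * g t ξ).re = ‖G ξ‖ := by
    have h1 := integral_re (𝕜 := ℂ) (hint.const_mul θ)
    refine h1.trans ?_
    rw [integral_const_mul]
    exact congrArg Complex.re hθG
  have hint' : Integrable (fun t => (θ * g t ξ).re) (volume.restrict (Ioo (0 : ℝ) 1)) :=
    (hint.const_mul θ).re
  -- A nonnegative function with nonpositive integral vanishes almost everywhere.
  have hzero : (fun t => (g t).supNorm - (θ * g t ξ).re) =ᵐ[volume.restrict (Ioo (0 : ℝ) 1)] 0 := by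
    have hnn : 0 ≤ᵐ[volume.restrict (Ioo (0 : ℝ) 1)] fun t => (g t).supNorm - (θ * g t ξ).re :=
      ae_restrict_of_forall_mem measurableSet_Ioo fun t ht =>
        sub_nonneg.2 ((Complex.re_le_norm _).trans (hnorm t ht))
    rw [← integral_eq_zero_iff_of_nonneg_ae hnn (hm.sub hint')]
    refine le_antisymm ?_ (integral_nonneg_of_ae hnn)
    rw [integral_sub hm hint', hre]
    exact sub_nonpos.2 hle
  filter_upwards [hzero, ae_restrict_mem measurableSet_Ioo] with t ht htI
  have h1 : (g t).supNorm = (θ * g t ξ).re := sub_eq_zero.1 ht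
  have h2 : (θ * g t ξ).re = ‖θ * g t ξ‖ :=
    le_antisymm (Complex.re_le_norm _) (h1 ▸ hnorm t htI)
  have h3 := Complex.re_eq_norm.1 h2
  rw [h1]
  exact (Complex.eq_re_of_ofReal_le h3)

theorem EN_operatorIntegral (hμ : Admissible p μ) (h1 : 1 < p) (hp : p ≠ ∞)
    (hg : ∀ t ∈ Ioo (0 : ℝ) 1, (g t).IsDiscAlgebra)
    (hW : ConditionW (fun t => (mulOp (g t) : HoloSpace p μ →L[ℂ] HoloSpace p μ))) :
    ∃ T : HoloSpace p μ →L[ℂ] HoloSpace p μ,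
      IsOperatorIntegral (fun t => (mulOp (g t) : HoloSpace p μ →L[ℂ] HoloSpace p μ)) T ∧
      EN T ≤ ∫⁻ t in Ioo (0 : ℝ) 1, EN (mulOp (g t) : HoloSpace p μ →L[ℂ] HoloSpace p μ) ∧
      (EN T = ∫⁻ t in Ioo (0 : ℝ) 1, EN (mulOp (g t) : HoloSpace p μ →L[ℂ] HoloSpace p μ) ↔
        ∃ ξ θ : ℂ, ‖ξ‖ = 1 ∧ ‖θ‖ = 1 ∧
          ∀ᵐ t ∂(volume.restrict (Ioo (0 : ℝ) 1)), θ * g t ξ = ((g t).supNorm : ℂ)) := by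
  have := hμ.completeSpace (p := p)
  obtain ⟨T, hT⟩ := hW.exists_isOperatorIntegral
  have hEN : ∫⁻ t in Ioo (0 : ℝ) 1, EN (mulOp (g t) : HoloSpace p μ →L[ℂ] HoloSpace p μ) =
      ∫⁻ t in Ioo (0 : ℝ) 1, ENNReal.ofReal (g t).supNorm :=
    setLIntegral_congr_fun measurableSet_Ioo fun t ht => hμ.EN_mulOp h1 hp (hg t ht)
  have hle : EN T ≤ ∫⁻ t in Ioo (0 : ℝ) 1, ENNReal.ofReal (g t).supNorm :=
    hT.EN_le.trans (lintegral_mono fun t => enorm_mulOp_le (g t))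
  rw [hEN]
  refine ⟨T, hT, hle, fun h => hμ.exists_peak_of_le_EN hg hW hT h.ge, ?_⟩
  rintro ⟨ξ, θ, hξ, hθ, h⟩
  exact le_antisymm hle (hμ.lintegral_supNorm_le_EN_of_peak h1 hp hg hW hT hξ hθ h)

end Admissible

end DiscSpaces

/-! ### Admissibility of the Hardy family -/

namespace DiscSpaces

lemma tendsto_measure_ball {ν : Measure ℂ} [IsFiniteMeasure ν] {ξ : ℂ} (hξ : ν {ξ} = 0) :
    Tendsto (fun δ : ℝ => ν (Metric.ball ξ δ)) (𝓝[>] 0) (𝓝 0) := by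
  have h1 : ⋂ δ > (0 : ℝ), Metric.ball ξ δ = {ξ} := by
    ext z
    simp only [mem_iInter, Metric.mem_ball, mem_singleton_iff]
    exact ⟨fun h => dist_le_zero.1 (le_of_forall_gt fun δ hδ => h δ hδ),
      fun h δ hδ => by simpa [h] using hδ⟩
  rw [← hξ, ← h1]
  exact tendsto_measure_biInter_gt (fun _ _ => Metric.isOpen_ball.measurableSet.nullMeasurableSet)
    (fun _ _ _ hij => Metric.ball_subset_ball hij) ⟨1, one_pos, measure_ne_top _ _⟩

lemma tendsto_rpow_zero {p : ℝ≥0∞} (hp0 : p ≠ 0) (hp : p ≠ ∞) {α : Type*} {l : Filter α}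
    {u : α → ℝ≥0∞} (hu : Tendsto u l (𝓝 0)) :
    Tendsto (fun a => u a ^ (1 / p.toReal)) l (𝓝 0) := by
  have hP : 0 < 1 / p.toReal := one_div_pos.2 (ENNReal.toReal_pos hp0 hp)
  have h := hu.ennrpow_const (1 / p.toReal)
  rwa [ENNReal.zero_rpow_of_pos hP] at h

lemma eLpNorm_indicator_one_le (p : ℝ≥0∞) (ν : Measure ℂ) (s : Set ℂ) :
    eLpNorm (s.indicator (1 : ℂ → ℂ)) p ν ≤ ν s ^ (1 / p.toReal) := by
  have := eLpNorm_indicator_const_le (s := s) (μ := ν) (c := (1 : ℂ)) p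
  rwa [enorm_one, one_mul] at this

lemma eLpNorm_indicator_one_ne_zero {p : ℝ≥0∞} (hp0 : p ≠ 0) {ν : Measure ℂ} {s : Set ℂ}
    (hs : MeasurableSet s) (h : ν s ≠ 0) : eLpNorm (s.indicator (1 : ℂ → ℂ)) p ν ≠ 0 := by
  intro h0
  rw [eLpNorm_eq_zero_iff (measurable_one.indicator hs).aestronglyMeasurable hp0] at h0
  refine h (measure_mono_null (fun z hz => ?_) h0)
  simp [hz]

section Circle

lemma measurable_circleMap (c : ℂ) (r : ℝ) : Measurable (circleMap c r) :=
  (continuous_circleMap c r).measurable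

lemma lintegral_circleMeasure (r : ℝ) {F : ℂ → ℝ≥0∞} (hF : Measurable F) :
    ∫⁻ z, F z ∂(circleMeasure r) =
      (ENNReal.ofReal (2 * Real.pi))⁻¹ * ∫⁻ u in Ioc 0 (2 * Real.pi), F (circleMap 0 r u) := by
  rw [circleMeasure, lintegral_map hF (measurable_circleMap 0 r), lintegral_smul_measure,
    smul_eq_mul]

lemma circleMeasure_apply (r : ℝ) {A : Set ℂ} (hA : MeasurableSet A) :
    circleMeasure r A = (ENNReal.ofReal (2 * Real.pi))⁻¹ *
      volume (circleMap 0 r ⁻¹' A ∩ Ioc 0 (2 * Real.pi)) := by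
  rw [circleMeasure, Measure.map_apply (measurable_circleMap 0 r) hA, Measure.smul_apply,
    Measure.restrict_apply (measurable_circleMap 0 r hA), smul_eq_mul]

instance (r : ℝ) : IsProbabilityMeasure (circleMeasure r) where
  measure_univ := by
    rw [circleMeasure_apply r MeasurableSet.univ, preimage_univ, univ_inter, Real.volume_Ioc,
      sub_zero]
    exact ENNReal.inv_mul_cancel (by simp [Real.pi_pos]) ENNReal.ofReal_ne_top

lemma circleMeasure_one_singleton (ξ : ℂ) : circleMeasure 1 {ξ} = 0 := by
  rw [circleMeasure_apply 1 (measurableSet_singleton ξ)]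
  have h : (circleMap 0 1 ⁻¹' {ξ} ∩ Ioc 0 (2 * Real.pi)).Subsingleton := fun u hu v hv =>
    injOn_circleMap_of_abs_sub_le one_ne_zero
      (by rw [zero_sub, abs_neg, abs_of_pos Real.two_pi_pos])
      (by rw [uIoc_of_le Real.two_pi_pos.le]; exact hu.2)
      (by rw [uIoc_of_le Real.two_pi_pos.le]; exact hv.2) (hu.1.trans hv.1.symm)
  rw [h.measure_zero, mul_zero]

/-- If |re^{iu} - ξ| < δ then 1 - r < δ, so |e^{iu} - ξ| < 2δ. This makes the smallness of the ball
uniform in r. -/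
lemma circleMeasure_ball_le {r : ℝ} (hr0 : 0 ≤ r) (hr : r < 1) {ξ : ℂ} (hξ : ‖ξ‖ = 1) (δ : ℝ) :
    circleMeasure r (Metric.ball ξ δ) ≤ circleMeasure 1 (Metric.ball ξ (2 * δ)) := by
  rw [circleMeasure_apply r Metric.isOpen_ball.measurableSet,
    circleMeasure_apply 1 Metric.isOpen_ball.measurableSet]
  gcongr
  intro u hu
  rw [mem_preimage, mem_ball_iff_norm] at hu ⊢
  have h1 : ‖circleMap 0 1 u - circleMap 0 r u‖ = 1 - r := by
    have : circleMap 0 1 u - circleMap 0 r u = circleMap 0 (1 - r) u := by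
      simp only [circleMap]
      push_cast
      ring
    rw [this, norm_circleMap_zero, abs_of_pos (by linarith)]
  have h2 : ‖ξ‖ ≤ ‖circleMap 0 r u - ξ‖ + ‖circleMap 0 r u‖ := by
    rw [norm_sub_rev]
    exact norm_le_norm_sub_add _ _
  rw [norm_circleMap_zero, abs_of_nonneg hr0, hξ] at h2
  calc ‖circleMap 0 1 u - ξ‖ ≤ ‖circleMap 0 1 u - circleMap 0 r u‖ + ‖circleMap 0 r u - ξ‖ :=
        norm_sub_le_norm_sub_add_norm_sub _ _ _
    _ < 2 * δ := by linarith

lemma circleMeasure_open_ne_zero {U : Set ℂ} (hU : IsOpen U) {z : ℂ} (hz : z ∈ U) :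
    circleMeasure ‖z‖ U ≠ 0 := by
  rw [circleMeasure_apply _ hU.measurableSet]
  refine mul_ne_zero (ENNReal.inv_ne_zero.2 ENNReal.ofReal_ne_top) ?_
  have hV : IsOpen (circleMap 0 ‖z‖ ⁻¹' U) := hU.preimage (continuous_circleMap 0 ‖z‖)
  have h1 : z ∈ circleMap 0 ‖z‖ '' Ioc 0 (2 * Real.pi) := by
    rw [image_circleMap_Ioc]
    simp
  obtain ⟨u, hu, hzu⟩ := h1
  -- The parameter may be the endpoint 2π, so it is approached from the open interval.
  have h2 : u ∈ closure (Ioo 0 (2 * Real.pi)) := by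
    rw [closure_Ioo Real.two_pi_pos.ne]
    exact Ioc_subset_Icc_self hu
  have h3 : (circleMap 0 ‖z‖ ⁻¹' U ∩ Ioo 0 (2 * Real.pi)).Nonempty :=
    mem_closure_iff.1 h2 _ hV (by rwa [mem_preimage, hzu])
  exact fun h => (hV.inter isOpen_Ioo).measure_ne_zero volume h3
    (measure_mono_null (inter_subset_inter_right _ Ioo_subset_Ioc_self) h)

lemma enorm_circleAverage_le (f : ℂ → ℂ) (c : ℂ) (R : ℝ) :
    ‖Real.circleAverage f c R‖ₑ ≤ (ENNReal.ofReal (2 * Real.pi))⁻¹ *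
      ∫⁻ u in Ioc 0 (2 * Real.pi), ‖f (circleMap c R u)‖ₑ := by
  rw [Real.circleAverage_def, enorm_smul, intervalIntegral.integral_of_le Real.two_pi_pos.le,
    ← ofReal_norm, norm_inv, Real.norm_of_nonneg Real.two_pi_pos.le,
    ENNReal.ofReal_inv_of_pos Real.two_pi_pos]
  gcongr
  exact enorm_integral_le_lintegral_enorm _

/-- The range (-π, π) is the angular range of polar coordinates. -/
lemma enorm_circleAverage_mul_le (f : ℂ → ℂ) (c : ℂ) (R : ℝ) :
    ‖Real.circleAverage f c R‖ₑ * ENNReal.ofReal (2 * Real.pi) ≤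
      ∫⁻ u in Ioo (-Real.pi) Real.pi, ‖f (circleMap c R u)‖ₑ := by
  rw [Real.circleAverage_eq_integral_add (-Real.pi),
    intervalIntegral.integral_comp_add_right (fun u => f (circleMap c R u)),
    show (0 : ℝ) + -Real.pi = -Real.pi by ring, show 2 * Real.pi + -Real.pi = Real.pi by ring,
    enorm_smul, intervalIntegral.integral_of_le (by linarith [Real.pi_pos]),
    ← ofReal_norm (E := ℝ), norm_inv, Real.norm_of_nonneg Real.two_pi_pos.le,
    ENNReal.ofReal_inv_of_pos Real.two_pi_pos, mul_right_comm,
    ENNReal.inv_mul_cancel (by simp [Real.pi_pos]) ENNReal.ofReal_ne_top, one_mul,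
    ← restrict_Ioo_eq_restrict_Ioc]
  exact enorm_integral_le_lintegral_enorm _

end Circle

lemma hardy_eval {p : ℝ≥0∞} (h1 : 1 ≤ p) {r : ℝ} (hr : r < 1) :
    ∃ C : ℝ≥0∞, C ≠ ∞ ∧ ∀ f : ℂ → ℂ, Measurable f → DifferentiableOn ℂ f disc →
      ∀ z ∈ Metric.closedBall (0 : ℂ) r, ‖f z‖ₑ ≤ C * extNorm p hardyMeasures f := by
  obtain ⟨R, hR, hR1⟩ := exists_between (max_lt hr one_pos)
  have hrR : r < R := (le_max_left _ _).trans_lt hR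
  have hR0 : 0 < R := (le_max_right _ _).trans_lt hR
  refine ⟨ENNReal.ofReal (R / (R - r)), ENNReal.ofReal_ne_top, fun f hm hf z hz => ?_⟩
  have hzr : ‖z‖ ≤ r := by simpa using hz
  have hd : DiffContOnCl ℂ f (Metric.ball 0 |R|) := by
    rw [abs_of_pos hR0]
    exact (hf.mono (Metric.closedBall_subset_ball hR1)).diffContOnCl_ball subset_rfl
  -- Cauchy's formula on the circle of radius R: the kernel ζ/(ζ - z) is at most R/(R - r), and for
  -- a probability measure the `L¹` norm is at most the `L^p` norm.
  rw [← hd.circleAverage_smul_div (w := z) (by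
    rw [abs_of_pos hR0, mem_ball_zero_iff]; exact hzr.trans_lt hrR)]
  refine (enorm_circleAverage_le _ _ _).trans ?_
  have h2 : eLpNorm f 1 (circleMeasure R) ≤ extNorm p hardyMeasures f :=
    (eLpNorm_le_eLpNorm_of_exponent_le h1 hm.aestronglyMeasurable).trans
      (le_iSup (fun i => eLpNorm f p (hardyMeasures i)) ⟨R, hR0.le, hR1⟩)
  refine le_trans ?_ (mul_le_mul_right h2 _)
  rw [eLpNorm_one_eq_lintegral_enorm, lintegral_circleMeasure R hm.enorm, mul_left_comm,
    ← lintegral_const_mul' _ _ ENNReal.ofReal_ne_top]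
  refine mul_le_mul_right (lintegral_mono fun u => ?_) _
  simp only [enorm_smul]
  refine mul_le_mul_left ?_ _
  rw [← ofReal_norm]
  refine ENNReal.ofReal_le_ofReal ?_
  have h3 : R - r ≤ ‖circleMap 0 R u - z‖ := by
    have := norm_sub_norm_le (circleMap 0 R u) z
    rw [norm_circleMap_zero, abs_of_pos hR0] at this
    linarith
  rw [sub_zero, norm_div, norm_circleMap_zero, abs_of_pos hR0]
  exact div_le_div_of_nonneg_left hR0.le (by linarith) h3

lemma admissible_hardy {p : ℝ≥0∞} (h1 : 1 ≤ p) (hp : p ≠ ∞) : Admissible p hardyMeasures where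
  extNorm_disc := by
    refine (iSup_le fun i => ?_).trans_lt ENNReal.one_lt_top
    refine (eLpNorm_indicator_one_le _ _ _).trans ?_
    refine ENNReal.rpow_le_one ?_ (by positivity)
    exact prob_le_one (μ := circleMeasure i)
  extNorm_open U hU hne hUd h := by
    obtain ⟨z, hz⟩ := hne
    have hz1 : ‖z‖ < 1 := by simpa using hUd hz
    exact eLpNorm_indicator_one_ne_zero (zero_lt_one.trans_le h1).ne' hU.measurableSet
      (circleMeasure_open_ne_zero hU hz) (ENNReal.iSup_eq_zero.1 h ⟨‖z‖, norm_nonneg z, hz1⟩)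
  extNorm_ball ξ hξ := by
    have h2 : Tendsto (fun δ : ℝ => 2 * δ) (𝓝[>] 0) (𝓝[>] 0) := by
      refine tendsto_nhdsWithin_iff.2 ⟨?_, ?_⟩
      · have : Tendsto (fun δ : ℝ => 2 * δ) (𝓝 0) (𝓝 (2 * 0)) := tendsto_id.const_mul 2
        rw [mul_zero] at this
        exact this.mono_left nhdsWithin_le_nhds
      · filter_upwards [self_mem_nhdsWithin] with δ hδ
        exact mul_pos two_pos (mem_Ioi.1 hδ)
    have h3 := tendsto_rpow_zero (zero_lt_one.trans_le h1).ne' hp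
      ((tendsto_measure_ball (circleMeasure_one_singleton ξ)).comp h2)
    refine tendsto_of_tendsto_of_tendsto_of_le_of_le tendsto_const_nhds h3 (fun _ => zero_le)
      fun δ => iSup_le fun i => (eLpNorm_indicator_one_le _ _ _).trans ?_
    refine ENNReal.rpow_le_rpow ?_ (by positivity)
    exact (measure_mono inter_subset_right).trans (circleMeasure_ball_le i.2.1 i.2.2 hξ δ)
  eval _ hr := hardy_eval h1 hr

end DiscSpaces

/-! ### Admissibility of the Bergman measure -/

namespace DiscSpaces

section Area

lemma polarCoord_symm_eq_circleMap (q : ℝ × ℝ) :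
    Complex.polarCoord.symm q = circleMap 0 q.1 q.2 := by
  rw [Complex.polarCoord_symm_apply, circleMap, zero_add, Complex.exp_mul_I, Complex.ofReal_cos,
    Complex.ofReal_sin]

/-- A crude form of the sub-mean value property over discs. -/
lemma enorm_mul_le_lintegral_ball {f : ℂ → ℂ} (hm : Measurable f) {z : ℂ} {s : ℝ}
    (hf : DifferentiableOn ℂ f (Metric.ball z s)) :
    ‖f z‖ₑ * (ENNReal.ofReal (2 * Real.pi) * ENNReal.ofReal (s / 2) * ENNReal.ofReal (s / 2)) ≤
      ∫⁻ w in Metric.ball z s, ‖f w‖ₑ := by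
  set F : ℂ → ℝ≥0∞ := fun w => (Metric.ball z s).indicator (fun w => ‖f w‖ₑ) (z + w)
  have hFm : Measurable F :=
    (hm.enorm.indicator Metric.isOpen_ball.measurableSet).comp (measurable_const_add z)
  have hshift : ∫⁻ w in Metric.ball z s, ‖f w‖ₑ = ∫⁻ w, F w := by
    rw [← lintegral_indicator Metric.isOpen_ball.measurableSet]
    exact (lintegral_add_left_eq_self _ z).symm
  have hcirc : ∀ ρ ∈ Ioo (s / 2) s, ‖f z‖ₑ * ENNReal.ofReal (2 * Real.pi) ≤
      ∫⁻ u in Ioo (-Real.pi) Real.pi, F (circleMap 0 ρ u) := by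
    intro ρ hρ
    have hρ0 : 0 < ρ := by linarith [hρ.1, hρ.2]
    have hd : DiffContOnCl ℂ f (Metric.ball z |ρ|) := by
      rw [abs_of_pos hρ0]
      exact (hf.mono (Metric.closedBall_subset_ball hρ.2)).diffContOnCl_ball subset_rfl
    have h1 := enorm_circleAverage_mul_le f z ρ
    rw [hd.circleAverage] at h1
    refine h1.trans_eq (lintegral_congr fun u => ?_)
    have h2 : z + circleMap 0 ρ u = circleMap z ρ u := by simp [circleMap]
    have h3 : circleMap z ρ u ∈ Metric.ball z s := by
      rw [← h2, mem_ball_iff_norm, add_sub_cancel_left, norm_circleMap_zero, abs_of_pos hρ0]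
      exact hρ.2
    simp only [F]
    rw [h2, indicator_of_mem h3]
  rw [hshift, ← Complex.lintegral_comp_polarCoord_symm, polarCoord_target,
    Measure.volume_eq_prod, ← Measure.prod_restrict]
  simp only [polarCoord_symm_eq_circleMap, smul_eq_mul]
  have hcm : Measurable fun q : ℝ × ℝ => circleMap 0 q.1 q.2 := by
    unfold circleMap
    fun_prop
  rw [lintegral_prod _ (by fun_prop)]
  simp only
  -- Only radii ρ in (s/2, s) are kept: the interval has length s/2 and the polar Jacobian is at
  -- least s/2 there, which gives the two factors.
  calc ‖f z‖ₑ * (ENNReal.ofReal (2 * Real.pi) * ENNReal.ofReal (s / 2) * ENNReal.ofReal (s / 2))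
      = ∫⁻ _ in Ioo (s / 2) s,
          ENNReal.ofReal (s / 2) * (‖f z‖ₑ * ENNReal.ofReal (2 * Real.pi)) := by
        rw [setLIntegral_const, Real.volume_Ioo, sub_half]
        ring
    _ ≤ ∫⁻ ρ in Ioo (s / 2) s, ∫⁻ u in Ioo (-Real.pi) Real.pi,
          ENNReal.ofReal ρ * F (circleMap 0 ρ u) := by
        refine setLIntegral_mono' measurableSet_Ioo fun ρ hρ => ?_
        rw [lintegral_const_mul' _ _ ENNReal.ofReal_ne_top]
        exact mul_le_mul' (ENNReal.ofReal_le_ofReal hρ.1.le) (hcirc ρ hρ)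
    _ ≤ _ := by
        refine lintegral_mono_set fun ρ hρ => ?_
        rw [mem_Ioi]
        linarith [hρ.1, hρ.2]

end Area

section Bergman

/-- In polar coordinates (1 - y²)^α = (1 + y)^α (1 - y)^α; the first factor is continuous on [0, 1]
and the second is integrable because α > -1. -/
lemma integrableOn_weight {α : ℝ} (hα : -1 < α) :
    IntegrableOn (fun z : ℂ => (α + 1) / Real.pi * (1 - ‖z‖ ^ 2) ^ α) disc := by
  have h1 : IntegrableOn (fun y : ℝ => (1 - y) ^ α) (Ioo 0 1) := by
    have h2 := ((intervalIntegral.intervalIntegrable_rpow' hα (a := 0) (b := 1)).comp_sub_left 1)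
    rw [sub_zero, sub_self] at h2
    exact ((intervalIntegrable_iff_integrableOn_Ioc_of_le zero_le_one).1 h2.symm).mono_set
      Ioo_subset_Ioc_self
  refine (integrableOn_fun_norm_addHaar (μ := volume) (E := ℂ)
    (f := fun y : ℝ => (α + 1) / Real.pi * (1 - y ^ 2) ^ α)).2 ?_
  have hc : ContinuousOn (fun y : ℝ => y * ((α + 1) / Real.pi * (1 + y) ^ α)) (Icc 0 1) := by
    refine continuousOn_id.mul (continuousOn_const.mul (ContinuousOn.rpow_const (by fun_prop) ?_))
    intro y hy
    exact Or.inl (by linarith [hy.1])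
  refine IntegrableOn.congr_fun (h1.continuousOn_mul_of_subset hc isCompact_Icc
    measurableSet_Ioo Ioo_subset_Icc_self) (fun y hy => ?_) measurableSet_Ioo
  have h3 : (1 - y ^ 2) ^ α = (1 + y) ^ α * (1 - y) ^ α := by
    rw [← Real.mul_rpow (by linarith [hy.1]) (by linarith [hy.2])]
    ring_nf
  simp only [Complex.finrank_real_complex, smul_eq_mul, h3]
  ring

variable {α : ℝ}

instance [hα : Fact (-1 < α)] : IsFiniteMeasure (bergmanMeasure α) where
  measure_univ_lt_top := by
    rw [bergmanMeasure, withDensity_apply _ MeasurableSet.univ, Measure.restrict_univ]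
    exact (integrableOn_weight hα.out).setLIntegral_lt_top

lemma weight_pos (hα : -1 < α) {z : ℂ} (hz : z ∈ disc) :
    0 < (α + 1) / Real.pi * (1 - ‖z‖ ^ 2) ^ α := by
  have hz1 : ‖z‖ < 1 := by simpa using hz
  have h1 : 0 < 1 - ‖z‖ ^ 2 := by nlinarith [norm_nonneg z]
  have h2 := Real.rpow_pos_of_pos h1 α
  have h3 : 0 < α + 1 := by linarith
  positivity

lemma bergmanMeasure_open_ne_zero (hα : -1 < α) {U : Set ℂ} (hU : IsOpen U) (hne : U.Nonempty)
    (hUd : U ⊆ disc) : bergmanMeasure α U ≠ 0 := by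
  intro h
  rw [bergmanMeasure, withDensity_apply_eq_zero (by fun_prop)] at h
  refine hU.measure_ne_zero volume hne ?_
  rw [← inter_eq_left.2 hUd, ← Measure.restrict_apply hU.measurableSet]
  refine measure_mono_null (fun z hz => mem_inter ?_ hz) h
  exact (ENNReal.ofReal_pos.2 (weight_pos hα (hUd hz))).ne'

lemma bergmanMeasure_singleton (ξ : ℂ) : bergmanMeasure α {ξ} = 0 :=
  withDensity_absolutelyContinuous _ _
    (Measure.absolutelyContinuous_of_le Measure.restrict_le_self (measure_singleton ξ))

/-- The weight has a positive minimum on a compact subdisc. -/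
lemma exists_setLIntegral_le_bergman (hα : -1 < α) {R : ℝ} (hR : R < 1) :
    ∃ C : ℝ≥0∞, C ≠ ∞ ∧ ∀ F : ℂ → ℝ≥0∞, Measurable F →
      ∫⁻ w in Metric.closedBall 0 R, F w ≤ C * ∫⁻ w, F w ∂(bergmanMeasure α) := by
  have hsub : Metric.closedBall (0 : ℂ) R ⊆ disc := Metric.closedBall_subset_ball hR
  obtain ⟨m, hm, hle⟩ : ∃ m > 0, ∀ z ∈ Metric.closedBall (0 : ℂ) R,
      m ≤ (α + 1) / Real.pi * (1 - ‖z‖ ^ 2) ^ α := by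
    rcases (Metric.closedBall (0 : ℂ) R).eq_empty_or_nonempty with h0 | hne
    · exact ⟨1, one_pos, by simp [h0]⟩
    · have hc : ContinuousOn (fun z : ℂ => (α + 1) / Real.pi * (1 - ‖z‖ ^ 2) ^ α)
          (Metric.closedBall (0 : ℂ) R) := by
        refine continuousOn_const.mul (ContinuousOn.rpow_const (by fun_prop) fun z hz => Or.inl ?_)
        have hz1 : ‖z‖ < 1 := by simpa using hsub hz
        nlinarith [norm_nonneg z]
      obtain ⟨z, hz, hmin⟩ := (isCompact_closedBall (0 : ℂ) R).exists_isMinOn hne hc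
      exact ⟨_, weight_pos hα (hsub hz), fun w hw => hmin hw⟩
  have hm0 : ENNReal.ofReal m ≠ 0 := (ENNReal.ofReal_pos.2 hm).ne'
  refine ⟨(ENNReal.ofReal m)⁻¹, ENNReal.inv_ne_top.2 hm0, fun F hF => ?_⟩
  rw [bergmanMeasure, lintegral_withDensity_eq_lintegral_mul _ (by fun_prop) hF,
    ← ENNReal.mul_le_iff_le_inv hm0 ENNReal.ofReal_ne_top,
    ← lintegral_const_mul' _ _ ENNReal.ofReal_ne_top]
  refine le_trans ?_ (lintegral_mono_set hsub)
  exact setLIntegral_mono' Metric.isClosed_closedBall.measurableSet fun z hz =>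
    mul_le_mul_left (ENNReal.ofReal_le_ofReal (hle z hz)) _

/-- Discs of radius R - r about points of the smaller disc stay in the disc of radius R, where area
measure is dominated by the weighted one; Hölder's inequality, with constant `V`, passes from `L¹`
to `L^p`. -/
lemma bergman_eval {p : ℝ≥0∞} (h1 : 1 ≤ p) [hα : Fact (-1 < α)] {r : ℝ} (hr : r < 1) :
    ∃ C : ℝ≥0∞, C ≠ ∞ ∧ ∀ f : ℂ → ℂ, Measurable f → DifferentiableOn ℂ f disc →
      ∀ z ∈ Metric.closedBall (0 : ℂ) r, ‖f z‖ₑ ≤ C * extNorm p (bergmanMeasures α) f := by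
  obtain ⟨R, hrR, hR1⟩ := exists_between hr
  have hs : 0 < R - r := sub_pos.2 hrR
  obtain ⟨C, hC, hCb⟩ := exists_setLIntegral_le_bergman hα.out hR1
  set K := ENNReal.ofReal (2 * Real.pi) * ENNReal.ofReal ((R - r) / 2) *
    ENNReal.ofReal ((R - r) / 2)
  have hK0 : K ≠ 0 := by
    refine mul_ne_zero (mul_ne_zero ?_ ?_) ?_
    · exact (ENNReal.ofReal_pos.2 Real.two_pi_pos).ne'
    · exact (ENNReal.ofReal_pos.2 (half_pos hs)).ne'
    · exact (ENNReal.ofReal_pos.2 (half_pos hs)).ne'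
  have hKt : K ≠ ∞ := ENNReal.mul_ne_top (ENNReal.mul_ne_top ENNReal.ofReal_ne_top
    ENNReal.ofReal_ne_top) ENNReal.ofReal_ne_top
  set V := bergmanMeasure α univ ^ (1 / (1 : ℝ≥0∞).toReal - 1 / p.toReal)
  have hV : V ≠ ∞ := by
    by_cases hp : p = ∞
    · simp [V, hp]
    refine ENNReal.rpow_ne_top_of_nonneg ?_ (measure_ne_top _ _)
    have h2 : 1 ≤ p.toReal := by
      rw [← ENNReal.toReal_one]
      exact ENNReal.toReal_mono hp h1
    rw [ENNReal.toReal_one, div_one, sub_nonneg]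
    exact div_le_one_of_le₀ h2 (by positivity)
  refine ⟨K⁻¹ * (C * V), ENNReal.mul_ne_top (ENNReal.inv_ne_top.2 hK0) (ENNReal.mul_ne_top hC hV),
    fun f hm hf z hz => ?_⟩
  have hball : Metric.ball z (R - r) ⊆ Metric.closedBall 0 R := by
    refine (Metric.ball_subset_closedBall).trans (Metric.closedBall_subset_closedBall' ?_)
    have : dist z 0 ≤ r := hz
    linarith
  have h2 := enorm_mul_le_lintegral_ball hm
    (hf.mono (hball.trans (Metric.closedBall_subset_ball hR1)))
  have h3 : eLpNorm f 1 (bergmanMeasure α) ≤ extNorm p (bergmanMeasures α) f * V :=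
    (eLpNorm_le_eLpNorm_mul_rpow_measure_univ h1 hm.aestronglyMeasurable).trans
      (mul_le_mul_left (le_iSup (fun i => eLpNorm f p (bergmanMeasures α i)) ()) _)
  rw [eLpNorm_one_eq_lintegral_enorm] at h3
  have h4 : K * ‖f z‖ₑ ≤ C * (extNorm p (bergmanMeasures α) f * V) := by
    rw [mul_comm]
    exact h2.trans ((lintegral_mono_set hball).trans
      ((hCb _ hm.enorm).trans (mul_le_mul_right h3 C)))
  rw [ENNReal.mul_le_iff_le_inv hK0 hKt] at h4
  refine h4.trans_eq ?_
  ring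

lemma admissible_bergman {p : ℝ≥0∞} (h1 : 1 ≤ p) (hp : p ≠ ∞) [hα : Fact (-1 < α)] :
    Admissible p (bergmanMeasures α) where
  extNorm_disc := by
    refine (iSup_le fun _ => eLpNorm_indicator_one_le _ _ _).trans_lt ?_
    exact ENNReal.rpow_lt_top_of_nonneg (by positivity) (measure_ne_top (bergmanMeasure α) _)
  extNorm_open U hU hne hUd h :=
    eLpNorm_indicator_one_ne_zero (zero_lt_one.trans_le h1).ne' hU.measurableSet
      (bergmanMeasure_open_ne_zero hα.out hU hne hUd) (ENNReal.iSup_eq_zero.1 h ())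
  extNorm_ball ξ _ := by
    have h3 := tendsto_rpow_zero (zero_lt_one.trans_le h1).ne' hp
      (tendsto_measure_ball (bergmanMeasure_singleton (α := α) ξ))
    refine tendsto_of_tendsto_of_tendsto_of_le_of_le tendsto_const_nhds h3 (fun _ => zero_le)
      fun δ => iSup_le fun i => (eLpNorm_indicator_one_le _ _ _).trans ?_
    exact ENNReal.rpow_le_rpow (measure_mono inter_subset_right) (by positivity)
  eval _ hr := bergman_eval h1 hr

end Bergman

end DiscSpaces

/-! ### The theorem for both scales of spaces -/

open DiscSpaces in
theorem mainTheorem2 (p : ℝ≥0∞) [Fact (1 ≤ p)] (hp : 1 < p) (hp' : p ≠ ∞)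
    (g : ℝ → HInfty) (hg : ∀ t ∈ Ioo (0 : ℝ) 1, (g t).IsDiscAlgebra) :
    (ConditionW (fun t => (mulOp (g t) : Hardy p →L[ℂ] Hardy p)) →
      ∃ T : Hardy p →L[ℂ] Hardy p,
        IsOperatorIntegral (fun t => (mulOp (g t) : Hardy p →L[ℂ] Hardy p)) T ∧
        EN T ≤ ∫⁻ t in Ioo (0 : ℝ) 1, EN (mulOp (g t) : Hardy p →L[ℂ] Hardy p) ∧
        (EN T = ∫⁻ t in Ioo (0 : ℝ) 1, EN (mulOp (g t) : Hardy p →L[ℂ] Hardy p) ↔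
          ∃ ξ θ : ℂ, ‖ξ‖ = 1 ∧ ‖θ‖ = 1 ∧
            ∀ᵐ t ∂(volume.restrict (Ioo (0 : ℝ) 1)), θ * g t ξ = ((g t).supNorm : ℂ))) ∧
    ∀ (α : ℝ) [Fact (-1 < α)],
      ConditionW (fun t => (mulOp (g t) : Bergman p α →L[ℂ] Bergman p α)) →
      ∃ T : Bergman p α →L[ℂ] Bergman p α,
        IsOperatorIntegral (fun t => (mulOp (g t) : Bergman p α →L[ℂ] Bergman p α)) T ∧
        EN T ≤ ∫⁻ t in Ioo (0 : ℝ) 1, EN (mulOp (g t) : Bergman p α →L[ℂ] Bergman p α) ∧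
        (EN T = ∫⁻ t in Ioo (0 : ℝ) 1, EN (mulOp (g t) : Bergman p α →L[ℂ] Bergman p α) ↔
          ∃ ξ θ : ℂ, ‖ξ‖ = 1 ∧ ‖θ‖ = 1 ∧
            ∀ᵐ t ∂(volume.restrict (Ioo (0 : ℝ) 1)), θ * g t ξ = ((g t).supNorm : ℂ)) := by
  have h1 : 1 ≤ p := Fact.out
  exact ⟨fun hW => (admissible_hardy h1 hp').EN_operatorIntegral hp hp' hg hW,
    fun α _ hW => (admissible_bergman h1 hp').EN_operatorIntegral hp hp' hg hW⟩
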